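/- Let $\mathbf k$ be a field. For a finite set $P\subset\mathbb R^2$ and $t\in\mathbb R$ let $\check C_t(P)$ be the \v{C}ech complex of $P$, whose simplices are the nonempty subsets $\{x_0,\dots,x_m\}\subseteq P$ such that the closed balls of radius $t$ in $\mathbb R^2$ around $x_0,\dots,x_m$ have a common point. Let $\mathrm{PH}_1(P)$ be the persistence module $t\mapsto \tilde H_1(\check C_t(P);\mathbf k)$, with the maps induced by inclusion, and let $\beta_1(P)$ be its barcode, that is, the multiset of nonempty intervals $I_1,\dots,I_m$ such that $\mathrm{PH}_1(P)$ is isomorphic to the direct sum of the interval modules of $I_1,\dots,I_m$. Let $X_1,X_2,X_3$ be independent random variables, uniformly distributed (with respect to arc length) on the unit circle $\mathbb S^1=\{x\in\mathbb R^2 : x_1^2+x_2^2=1\}$, and let $P_3=\{X_1,X_2,X_3\}$. Then the barcode of $\mathrm{PH}_1(P_3)$ exists, is unique, and consists of at most one interval, which is contained in $[0,1]$. Let $\ell(\beta_1(P_3))\in[0,1]$ be the length of this interval, with $\ell(\beta_1(P_3))=0$ if there is none. Then $\ell(\beta_1(P_3))$ is integrable and $$\mathbb E[\ell(\beta_1(P_3))]=\frac{9(\sqrt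 3-2)}{\pi^2}+\frac14 .$$ -/

import Mathlib

open MeasureTheory

/-! ### Homology of a pair of linear maps -/

section Homology

variable {𝕜 A B C A' B' C' : Type*} [Field 𝕜]
  [AddCommGroup A] [Module 𝕜 A] [AddCommGroup B] [Module 𝕜 B] [AddCommGroup C] [Module 𝕜 C]
  [AddCommGroup A'] [Module 𝕜 A'] [AddCommGroup B'] [Module 𝕜 B'] [AddCommGroup C'] [Module 𝕜 C']

/-- The homology `ker g / im f` of `A → B → C` at `B`. -/
abbrev HomologyAt (f : A →ₗ[𝕜] B) (g : B →ₗ[𝕜] C) : Type _ :=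
  ↥(LinearMap.ker g) ⧸ (LinearMap.range f).submoduleOf (LinearMap.ker g)

/-- The map `ker g / im f → ker g' / im f'` induced by a morphism of complexes. -/
def HomologyAt.map {f : A →ₗ[𝕜] B} {g : B →ₗ[𝕜] C} {f' : A' →ₗ[𝕜] B'} {g' : B' →ₗ[𝕜] C'}
    (α : A →ₗ[𝕜] A') (β : B →ₗ[𝕜] B') (γ : C →ₗ[𝕜] C')
    (hf : ∀ a, f' (α a) = β (f a)) (hg : ∀ b, g' (β b) = γ (g b)) :
    HomologyAt f g →ₗ[𝕜] HomologyAt f' g' :=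
  Submodule.mapQ _ _
    (β.restrict fun b hb => by
      rw [LinearMap.mem_ker] at hb ⊢
      rw [hg, hb, map_zero])
    (by
      rintro x ⟨a, ha⟩
      exact ⟨α a, by rw [hf, ha]; rfl⟩)

end Homology

/-! ### Simplicial homology of abstract simplicial complexes -/

section Simplicial

universe u v

variable (𝕜 : Type u) [Field 𝕜] {V : Type v}

/-- Oriented simplicial chains on `n` vertices (that is, of dimension `n - 1`) of the simplicial
complex `K`, with coefficients in `𝕜`. Such a chain is a finitely supported function `c` on ordered
tuples `(x₀, …, xₙ₋₁)` of vertices which vanishes unless the `xᵢ` are the pairwise distinct vertices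
of a simplex of `K`, and which changes sign under odd permutations of the tuple; the elementary
chain of the oriented simplex `[x₀, …, xₙ₋₁]` takes the value `sign σ` on `x ∘ σ`, and `0` on
all other tuples. For `n = 0` the empty tuple is allowed: this is the term of degree `-1` of the
augmented chain complex. -/
def simplicialChains (K : PreAbstractSimplicialComplex V) (n : ℕ) :
    Submodule 𝕜 ((Fin n → V) → 𝕜) where
  carrier := {c | c.support.Finite ∧
    (∀ x : Fin n → V, c x ≠ 0 → Function.Injective x ∧
      (n = 0 ∨ ∃ s ∈ K, (s : Set V) = Set.range x)) ∧
    ∀ (x : Fin n → V) (σ : Equiv.Perm (Fin n)),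
      c (x ∘ σ) = ((Equiv.Perm.sign σ : ℤ) : 𝕜) * c x}
  zero_mem' := by simp
  add_mem' := by
    rintro a b ⟨hf, ha, ha'⟩ ⟨hg, hb, hb'⟩
    refine ⟨(hf.union hg).subset (Function.support_add a b), fun x hx => ?_,
      fun x σ => by simp [ha', hb', mul_add]⟩
    by_cases h : a x = 0
    · exact hb x (by simpa [h] using hx)
    · exact ha x h
  smul_mem' := by
    rintro r a ⟨hf, ha, ha'⟩
    refine ⟨hf.subset (Function.support_const_smul_subset r a),
      fun x hx => ha x fun h => hx (by simp [h]), fun x σ => ?_⟩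
    simp only [Pi.smul_apply, ha', smul_eq_mul]
    ring

variable {𝕜} in
/-- The coefficients of the boundary of a chain can be computed by summing over any finite set of
vertices that contains all vertices of the chain. -/
theorem finsum_cons_eq_sum {n : ℕ} (c : (Fin (n + 1) → V) → 𝕜) (S : Finset V)
    (hS : ∀ x, c x ≠ 0 → x 0 ∈ S) (y : Fin n → V) :
    ∑ᶠ v, c (Fin.cons v y) = ∑ v ∈ S, c (Fin.cons v y) :=
  finsum_eq_sum_of_support_subset _ fun v hv => by simpa using hS _ hv

/-- A finite set of vertices that contains all vertices of a given chain. -/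
theorem exists_finset_vertices {n : ℕ} {c : (Fin n → V) → 𝕜} (hc : c.support.Finite) :
    ∃ S : Finset V, ∀ x, c x ≠ 0 → ∀ i, x i ∈ S := by
  classical
  exact ⟨hc.toFinset.biUnion fun x => Finset.univ.image x, fun x hx i =>
    Finset.mem_biUnion.2 ⟨x, by simpa using hx, by simp⟩⟩

theorem boundary_mem_chains (K : PreAbstractSimplicialComplex V) (n : ℕ)
    {c : (Fin (n + 1) → V) → 𝕜} (hc : c ∈ simplicialChains 𝕜 K (n + 1)) :
    (fun y : Fin n → V => ∑ᶠ v, c (Fin.cons v y)) ∈ simplicialChains 𝕜 K n := by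
  classical
  obtain ⟨hf, h1, h2⟩ := hc
  obtain ⟨S, hS⟩ := exists_finset_vertices 𝕜 hf
  simp only [finsum_cons_eq_sum c S fun x hx => hS x hx 0]
  refine ⟨(hf.image Fin.tail).subset fun y hy => ?_, fun y hy => ?_, fun y σ => ?_⟩
  · obtain ⟨v, -, hv⟩ := Finset.exists_ne_zero_of_sum_ne_zero hy
    exact ⟨_, hv, by simp⟩
  · obtain ⟨v, -, hv⟩ := Finset.exists_ne_zero_of_sum_ne_zero hy
    obtain ⟨hi, hK⟩ := h1 _ hv
    refine ⟨(Fin.cons_injective_iff.1 hi).2, ?_⟩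
    rcases Nat.eq_zero_or_pos n with h0 | h0
    · exact Or.inl h0
    · right
      obtain h | ⟨s, hs, hsx⟩ := hK
      · simp at h
      · refine ⟨Finset.univ.image y, (K.isRelLowerSet_faces hs).2 ?_ ?_, by simp⟩
        · intro a ha
          have : a ∈ (s : Set V) := by
            rw [hsx, Fin.range_cons]
            right
            simpa using ha
          simpa using this
        · exact ⟨y ⟨0, h0⟩, by simp⟩
  · rw [Finset.mul_sum]
    refine Finset.sum_congr rfl fun v _ => ?_
    have := h2 (Fin.cons v y) (Equiv.Perm.decomposeFin.symm (0, σ))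
    rw [Equiv.Perm.decomposeFin.symm_sign] at this
    simp only [if_true, one_mul] at this
    rw [← this]
    congr 1
    funext i
    refine Fin.cases ?_ (fun j => ?_) i <;> simp

/-- The boundary operator on oriented chains: the coefficient of `∂ c` at `(y₁, …, yₙ)` is
`∑ v, c (v, y₁, …, yₙ)`. On the elementary chain of `[x₀, …, xₙ]` this is the usual
`∑ i, (-1) ^ i [x₀, …, x̂ᵢ, …, xₙ]`, because moving `xᵢ` to the front costs the sign `(-1) ^ i`. On
chains on one vertex (`n = 0`) it is the augmentation `c ↦ ∑ v, c v`. -/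
noncomputable def simplicialBoundary (K : PreAbstractSimplicialComplex V) (n : ℕ) :
    simplicialChains 𝕜 K (n + 1) →ₗ[𝕜] simplicialChains 𝕜 K n where
  toFun c := ⟨fun y => ∑ᶠ v, c.1 (Fin.cons v y), boundary_mem_chains 𝕜 K n c.2⟩
  map_add' a b := by
    classical
    obtain ⟨S, hS⟩ := exists_finset_vertices 𝕜 a.2.1
    obtain ⟨T, hT⟩ := exists_finset_vertices 𝕜 b.2.1
    ext y
    change ∑ᶠ v, (a.1 + b.1) (Fin.cons v y)
      = ∑ᶠ v, a.1 (Fin.cons v y) + ∑ᶠ v, b.1 (Fin.cons v y)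
    rw [finsum_cons_eq_sum a.1 (S ∪ T) fun x hx => Finset.mem_union_left _ (hS x hx 0),
      finsum_cons_eq_sum b.1 (S ∪ T) fun x hx => Finset.mem_union_right _ (hT x hx 0),
      finsum_cons_eq_sum (a.1 + b.1) (S ∪ T), ← Finset.sum_add_distrib]
    · rfl
    · intro x hx
      by_cases h : a.1 x = 0
      · exact Finset.mem_union_right _ (hT x (by simpa [h] using hx) 0)
      · exact Finset.mem_union_left _ (hS x h 0)
  map_smul' r a := by
    ext y
    exact (smul_finsum r fun v => a.1 (Fin.cons v y)).symm

/-- `∂ ∘ ∂ = 0`. -/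
theorem simplicialBoundary_boundary (K : PreAbstractSimplicialComplex V) (n : ℕ)
    (c : simplicialChains 𝕜 K (n + 2)) :
    simplicialBoundary 𝕜 K n (simplicialBoundary 𝕜 K (n + 1) c) = 0 := by
  classical
  obtain ⟨c, hf, h1, h2⟩ := c
  obtain ⟨S, hS⟩ := exists_finset_vertices 𝕜 hf
  ext y
  change ∑ᶠ v, ∑ᶠ w, c (Fin.cons w (Fin.cons v y)) = 0
  simp only [finsum_cons_eq_sum c S fun x hx => hS x hx 0]
  rw [finsum_cons_eq_sum (fun z => ∑ w ∈ S, c (Fin.cons w z)) S (fun z hz => ?_) y]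
  swap
  · obtain ⟨w, -, hw⟩ := Finset.exists_ne_zero_of_sum_ne_zero hz
    simpa using hS _ hw 1
  rw [← Finset.sum_product']
  have hswap : ∀ v w : V, c (Fin.cons v (Fin.cons w y)) = - c (Fin.cons w (Fin.cons v y)) := by
    intro v w
    have := h2 (Fin.cons w (Fin.cons v y)) (Equiv.swap 0 1)
    rw [Equiv.Perm.sign_swap (by simp)] at this
    simp only [Units.val_neg, Units.val_one, Int.cast_neg, Int.cast_one, neg_mul, one_mul] at this
    rw [← this]
    congr 1
    funext i
    refine Fin.cases ?_ (fun j => Fin.cases ?_ (fun l => ?_) j) i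
    · simp
    · simp
    · rw [Function.comp_apply, Equiv.swap_apply_of_ne_of_ne]
      · simp
      · exact Fin.succ_ne_zero _
      · exact fun h => Fin.succ_ne_zero l (Fin.succ_injective _ h)
  refine Finset.sum_involution (fun p _ => (p.2, p.1)) ?_ ?_ ?_ ?_
  · rintro ⟨v, w⟩ _
    simp only
    rw [hswap v w]
    simp
  · rintro ⟨v, w⟩ _ hne heq
    obtain rfl : w = v := congrArg Prod.fst heq
    have h01 : (0 : Fin (n + 2)) = 1 := (h1 _ hne).1 (by simp)
    simp at h01
  · rintro ⟨v, w⟩ h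
    simpa [and_comm] using h
  · rintro ⟨v, w⟩ _
    rfl

/-- The reduced simplicial homology `H̃ₖ(K; 𝕜)`, i.e. cycles modulo boundaries of the augmented
oriented chain complex (`∂ ∘ ∂ = 0` by `simplicialBoundary_boundary`). For `k ≠ 0` it is the
ordinary simplicial homology. -/
abbrev ReducedHomology (K : PreAbstractSimplicialComplex V) (k : ℕ) : Type (max u v) :=
  HomologyAt (simplicialBoundary 𝕜 K (k + 1)) (simplicialBoundary 𝕜 K k)

theorem simplicialChains_mono {K L : PreAbstractSimplicialComplex V} (h : K ≤ L) (n : ℕ) :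
    simplicialChains 𝕜 K n ≤ simplicialChains 𝕜 L n := by
  rintro c ⟨hf, h1, h2⟩
  exact ⟨hf, fun x hx => ⟨(h1 x hx).1, (h1 x hx).2.imp_right fun ⟨s, hs, e⟩ => ⟨s, h hs, e⟩⟩, h2⟩

/-- The map on chains induced by the inclusion of a subcomplex. -/
abbrev chainInclusion {K L : PreAbstractSimplicialComplex V} (h : K ≤ L) (n : ℕ) :
    simplicialChains 𝕜 K n →ₗ[𝕜] simplicialChains 𝕜 L n :=
  Submodule.inclusion (simplicialChains_mono 𝕜 h n)

theorem simplicialBoundary_inclusion {K L : PreAbstractSimplicialComplex V} (h : K ≤ L) (n : ℕ)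
    (c : simplicialChains 𝕜 K (n + 1)) :
    simplicialBoundary 𝕜 L n (chainInclusion 𝕜 h (n + 1) c) =
      chainInclusion 𝕜 h n (simplicialBoundary 𝕜 K n c) :=
  rfl

/-- The map in homology induced by the inclusion of a subcomplex. -/
noncomputable def ReducedHomology.map {K L : PreAbstractSimplicialComplex V} (h : K ≤ L) (k : ℕ) :
    ReducedHomology 𝕜 K k →ₗ[𝕜] ReducedHomology 𝕜 L k :=
  HomologyAt.map (chainInclusion 𝕜 h (k + 2)) (chainInclusion 𝕜 h (k + 1)) (chainInclusion 𝕜 h k)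
    (simplicialBoundary_inclusion 𝕜 h (k + 1)) (simplicialBoundary_inclusion 𝕜 h k)

end Simplicial

/-! ### Persistence modules and barcodes -/

/-- A persistence module over the field `𝕜`, indexed by `ℝ`. -/
structure PersistenceModule.{w, u} (𝕜 : Type u) [Field 𝕜] where
  V : ℝ → Type w
  [addCommGroup : ∀ t, AddCommGroup (V t)]
  [module : ∀ t, Module 𝕜 (V t)]
  map : ∀ s t : ℝ, s ≤ t → V s →ₗ[𝕜] V t
  map_self : ∀ t, map t t le_rfl = LinearMap.id
  map_comp : ∀ r s t (hrs : r ≤ s) (hst : s ≤ t),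
    (map s t hst).comp (map r s hrs) = map r t (hrs.trans hst)

attribute [instance] PersistenceModule.addCommGroup PersistenceModule.module

/-- A nonempty interval of real numbers, with or without its endpoints (possibly unbounded). -/
@[ext]
structure BarInterval where
  carrier : Set ℝ
  nonempty : carrier.Nonempty
  ordConnected : carrier.OrdConnected

namespace PersistenceModule

universe w w' u

variable {𝕜 : Type u} [Field 𝕜]

/-- An isomorphism of persistence modules. -/
structure Iso (A : PersistenceModule.{w} 𝕜) (B : PersistenceModule.{w'} 𝕜) where
  equiv : ∀ t, A.V t ≃ₗ[𝕜] B.V t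
  comm : ∀ (s t : ℝ) (h : s ≤ t) (x : A.V s), equiv t (A.map s t h x) = B.map s t h (equiv s x)

/-- The direct sum of a family of persistence modules. -/
noncomputable def directSum {Λ : Type w'} (A : Λ → PersistenceModule.{w} 𝕜) :
    PersistenceModule.{max w w'} 𝕜 where
  V t := Π₀ i, (A i).V t
  map s t h := DFinsupp.mapRange.linearMap fun i => (A i).map s t h
  map_self t := by
    simp only [map_self]
    exact DFinsupp.mapRange.linearMap_id
  map_comp r s t hrs hst := by
    simp only [← map_comp _ r s t hrs hst]
    exact (DFinsupp.mapRange.linearMap_comp _ _).symm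

open Classical in
/-- The interval module: its value at `t` is `𝕜` for `t ∈ I` and `0` otherwise (realised as a
subspace of `𝕜`); the map from `s` to `t` is the identity of `𝕜` if `s` and `t` are in `I`, and `0`
otherwise. -/
noncomputable def intervalModule (𝕜 : Type u) [Field 𝕜] (I : BarInterval) :
    PersistenceModule.{u} 𝕜 where
  V t := ↥({ carrier := {x | t ∉ I.carrier → x = 0}
             add_mem' := fun ha hb ht => by rw [ha ht, hb ht, add_zero]
             zero_mem' := fun _ => rfl
             smul_mem' := fun r a ha ht => by rw [ha ht, smul_zero] } : Submodule 𝕜 𝕜)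
  map s t _ :=
    if ht : t ∈ I.carrier then
      (Submodule.subtype _).codRestrict _ (fun _ h => absurd ht h)
    else 0
  map_self t := by
    split_ifs with h
    · rfl
    · ext x
      simpa using (x.2 h).symm
  map_comp r s t hrs hst := by
    ext x
    by_cases ht : t ∈ I.carrier
    · by_cases hs : s ∈ I.carrier
      · simp [ht, hs]
      · have hr : r ∉ I.carrier := fun hr => hs (I.ordConnected.out hr ht ⟨hrs, hst⟩)
        simpa [ht, hs] using (x.2 hr).symm
    · simp [ht]

/-- The finite multiset `b` of intervals is a barcode of `A`: the persistence module `A` is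
isomorphic to the direct sum of the interval modules of the intervals in `b`, taken with their
multiplicities. -/
def IsBarcode (A : PersistenceModule.{w} 𝕜) (b : Multiset BarInterval) : Prop :=
  ∃ (m : ℕ) (I : Fin m → BarInterval), Finset.univ.val.map I = b ∧
    Nonempty (Iso A (directSum fun i => intervalModule 𝕜 (I i)))

open Classical in
/-- The barcode of a decomposable persistence module of finite type (and `0` if `A` is not of
this kind). -/
noncomputable def barcode (A : PersistenceModule.{w} 𝕜) : Multiset BarInterval :=
  if h : ∃ b, A.IsBarcode b then h.choose else 0

end PersistenceModule

/-- The space of barcode representations: finite multisets of pairs `(x, d)` of nonnegative reals,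
where `x` is the left endpoint of a bar and `d` its length, up to bars of length zero; each class
is represented by its unique member without bars of length zero. -/
def BarcodeSpace : Type := {b : Multiset (NNReal × NNReal) // ∀ p ∈ b, p.2 ≠ 0}

open Classical in
/-- The representation of a barcode all of whose intervals have nonnegative left endpoint and finite
length: each interval is replaced by its left endpoint and its length. -/
noncomputable def barcodeRepresentation (b : Multiset BarInterval) : BarcodeSpace :=
  ⟨(b.map fun I => ((sInf I.carrier).toNNReal, (sSup I.carrier - sInf I.carrier).toNNReal)).filter
    fun p => p.2 ≠ 0, fun _ hp => (Multiset.mem_filter.1 hp).2⟩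

/-- The length of a barcode with at most one bar: the length of this bar, and `0` if there is none
(in general, the sum of the lengths of all bars). -/
noncomputable def BarcodeSpace.length (b : BarcodeSpace) : ℝ :=
  ((b.1.map fun p => p.2).sum : NNReal)

/-! ### Persistent homology of finite point clouds -/

section Cech

universe u v

variable {M : Type v} [MetricSpace M]

/-- The Čech complex with parameter `t` of a finite subset `P` of a metric space `M`: a nonempty
subset of `P` is a simplex iff the closed `t`-balls of `M` around its points have a common point. -/
def cechComplex (P : Finset M) (t : ℝ) : PreAbstractSimplicialComplex M where
  faces := {s | s.Nonempty ∧ s ⊆ P ∧ (⋂ x ∈ s, Metric.closedBall x t).Nonempty}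
  isRelLowerSet_faces := by
    rintro s ⟨hs, hsP, z, hz⟩
    refine ⟨hs, fun r hr hr' => ⟨hr', hr.trans hsP, z, ?_⟩⟩
    simp only [Set.mem_iInter] at hz ⊢
    exact fun x hx => hz x (hr hx)

theorem cechComplex_mono (P : Finset M) {s t : ℝ} (h : s ≤ t) :
    cechComplex P s ≤ cechComplex P t := by
  rintro r ⟨hr, hrP, z, hz⟩
  refine ⟨hr, hrP, z, ?_⟩
  simp only [Set.mem_iInter] at hz ⊢
  exact fun x hx => Metric.closedBall_subset_closedBall h (hz x hx)

/-- The persistent homology in degree `k` of a finite subset `P` of a metric space `M`: the reduced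
homology of the Čech filtration of `P`. -/
noncomputable def persistentHomology (𝕜 : Type u) [Field 𝕜] (k : ℕ) (P : Finset M) :
    PersistenceModule.{max u v} 𝕜 where
  V t := ReducedHomology 𝕜 (cechComplex P t) k
  map _ _ h := ReducedHomology.map 𝕜 (cechComplex_mono P h) k
  map_self t := by
    ext x
    rfl
  map_comp r s t hrs hst := by
    ext x
    rfl

/-- The `k`-th barcode map `P ↦ βₖ(P)`. -/
noncomputable def barcodeMap (𝕜 : Type u) [Field 𝕜] (k : ℕ) (P : Finset M) : BarcodeSpace :=
  barcodeRepresentation (persistentHomology 𝕜 k P).barcode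

end Cech

/-! ### Random points on the circle -/

/-- The Euclidean plane. -/
abbrev Plane : Type := EuclideanSpace ℝ (Fin 2)

/-- The unit circle in the Euclidean plane. -/
abbrev UnitCircle : Type := Metric.sphere (0 : Plane) 1

/-- The arc length measure on the unit circle. -/
noncomputable def arcLength : Measure UnitCircle := (volume : Measure Plane).toSphere

open Classical in
/-- The finite subset `{X₁, X₂, X₃}` of the plane. -/
noncomputable def pointCloud (x : Fin 3 → UnitCircle) : Finset Plane :=
  Finset.univ.image fun i => (x i : Plane)

/-! Three points span a complex whose first homology is nonzero exactly when all three edges are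
present and the triangle is not. An edge enters at half its length. If some angle is not acute, the
disk over the opposite side contains the third point, so the triangle is filled as soon as its edges
are there and no bar arises. If the triangle is acute, its circumcenter, the origin, is a positive
combination of the vertices; this forces every disk containing them to have radius at least 1, so
the triangle enters at `t = 1`. With `L` the longest side, the bar is `[L/2, 1)`, of length `1 -
L/2` (`IsAcute.exists_intervalCoordinate`, `subsingleton_persistentHomology_of_not_isAcute`).
Uniqueness of the barcode is proved directly (`IntervalCoordinate.eq_singleton_of_isBarcode`), as
all spaces have dimension at most one.

For the expectation, polar coordinates identify the arc length with Lebesgue measure on angles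
(`arcLength_eq_map`), and rotation puts one vertex at angle `0`. With the others at `u ∈ (0, π)` and
`v ∈ (0, 2π)`, the triangle is acute iff `π < v < π + u`, and half its longest side is the maximum
of `sin (u/2)`, `sin ((v-u)/2)` and `sin (v/2)`. The reflection `v ↦ 2π + u - v` exchanges the last
two, and the maximum changes form at the equilateral value `u = 2π/3`. Elementary integration gives
`π² - 72 + 36√3`, to be divided by `(2π)²`. -/

/-! ### Barcodes of interval modules -/

namespace PersistenceModule

universe w u

variable {𝕜 : Type u} [Field 𝕜]

/-- The canonical generator of the interval module of `I` at a point `t` of `I`. -/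
def intervalGenerator (𝕜 : Type u) [Field 𝕜] {I : BarInterval} {t : ℝ} (ht : t ∈ I.carrier) :
    (intervalModule 𝕜 I).V t :=
  ⟨1, fun h => absurd ht h⟩

theorem intervalGenerator_ne_zero {I : BarInterval} {t : ℝ} (ht : t ∈ I.carrier) :
    intervalGenerator 𝕜 ht ≠ 0 := fun h => one_ne_zero (α := 𝕜) (congrArg Subtype.val h)

theorem intervalModule_map_of_notMem {I : BarInterval} {s t : ℝ} (h : s ≤ t)
    (ht : t ∉ I.carrier) : (intervalModule 𝕜 I).map s t h = 0 :=
  dif_neg ht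

theorem intervalModule_map_val {I : BarInterval} {s t : ℝ} (h : s ≤ t)
    (ht : t ∈ I.carrier) (x : (intervalModule 𝕜 I).V s) :
    ((intervalModule 𝕜 I).map s t h x).1 = x.1 := by
  simp only [intervalModule, ht, dite_true]
  rfl

theorem directSum_map_single {Λ : Type} [DecidableEq Λ] (A : Λ → PersistenceModule.{w} 𝕜)
    {s t : ℝ} (h : s ≤ t) (i : Λ) (x : (A i).V s) :
    (directSum A).map s t h (DFinsupp.single i x : Π₀ i, (A i).V s) =
      (DFinsupp.single i ((A i).map s t h x) : Π₀ i, (A i).V t) :=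
  DFinsupp.mapRange_single (hf := fun _ => map_zero _)

theorem single_intervalGenerator_ne_zero {m : ℕ} (I : Fin m → BarInterval) (i : Fin m) {t : ℝ}
    (ht : t ∈ (I i).carrier) :
    (DFinsupp.single i (intervalGenerator 𝕜 ht) : Π₀ i, (intervalModule 𝕜 (I i)).V t) ≠ 0 := by
  intro h
  have := DFunLike.congr_fun h i
  rw [DFinsupp.single_eq_same] at this
  exact intervalGenerator_ne_zero ht this

theorem isBarcode_zero (A : PersistenceModule.{w} 𝕜) (hA : ∀ t, Subsingleton (A.V t)) :
    A.IsBarcode 0 := by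
  refine ⟨0, Fin.elim0, rfl, ⟨⟨fun t => ?_, fun s t h x => ?_⟩⟩⟩
  · have : Subsingleton ((directSum fun i => intervalModule 𝕜 (Fin.elim0 i)).V t) :=
      inferInstanceAs (Subsingleton (Π₀ i : Fin 0, (intervalModule 𝕜 (Fin.elim0 i)).V t))
    exact 0
  · have : Subsingleton ((directSum fun i => intervalModule 𝕜 (Fin.elim0 i)).V t) :=
      inferInstanceAs (Subsingleton (Π₀ i : Fin 0, (intervalModule 𝕜 (Fin.elim0 i)).V t))
    exact Subsingleton.elim _ _

/-- A bar is nonempty, so at any of its points its generator would be a nonzero vector in a zero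
space. -/
theorem IsBarcode.eq_zero {A : PersistenceModule.{w} 𝕜} (hA : ∀ t, Subsingleton (A.V t))
    {b : Multiset BarInterval} (hb : A.IsBarcode b) : b = 0 := by
  obtain ⟨m, I, rfl, ⟨Φ⟩⟩ := hb
  rcases Nat.eq_zero_or_pos m with rfl | hm
  · rfl
  · exfalso
    obtain ⟨t, ht⟩ := (I ⟨0, hm⟩).nonempty
    have hs := (Φ.equiv t).symm.injective.subsingleton
    have h0 : (DFinsupp.single ⟨0, hm⟩ (intervalGenerator 𝕜 ht) :
        Π₀ i, (intervalModule 𝕜 (I i)).V t) = 0 := hs.elim _ _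
    exact single_intervalGenerator_ne_zero I _ ht h0

/-- A family of coordinates that identifies `A` with the interval module of `J`. -/
structure IntervalCoordinate (A : PersistenceModule.{w} 𝕜) (J : BarInterval) where
  coord : ∀ t, A.V t →ₗ[𝕜] 𝕜
  subsingleton : ∀ t, t ∉ J.carrier → Subsingleton (A.V t)
  bijective : ∀ t, t ∈ J.carrier → Function.Bijective (coord t)
  comm : ∀ (s t : ℝ) (h : s ≤ t), s ∈ J.carrier → t ∈ J.carrier →
    ∀ x, coord t (A.map s t h x) = coord s x

namespace IntervalCoordinate

variable {A : PersistenceModule.{w} 𝕜} {J : BarInterval}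

open Classical in
/-- The linear map to the interval module given by the coordinates. -/
noncomputable def toInterval (φ : A.IntervalCoordinate J) (t : ℝ) : A.V t →ₗ[𝕜] (intervalModule 𝕜 J).V t where
  toFun x := ⟨if t ∈ J.carrier then φ.coord t x else 0, fun h => if_neg h⟩
  map_add' x y := Subtype.ext (by
    change ite _ _ _ = ite _ _ _ + ite _ _ _
    split_ifs <;> simp)
  map_smul' r x := Subtype.ext (by
    change ite _ _ _ = r • ite _ _ _
    split_ifs <;> simp)

theorem toInterval_val (φ : A.IntervalCoordinate J) {t : ℝ} (ht : t ∈ J.carrier) (x : A.V t) :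
    (φ.toInterval t x).1 = φ.coord t x := by
  exact if_pos ht

theorem toInterval_bijective (φ : A.IntervalCoordinate J) (t : ℝ) : Function.Bijective (φ.toInterval t) := by
  by_cases ht : t ∈ J.carrier
  · refine ⟨fun x y h => (φ.bijective t ht).1 ?_, fun y => ?_⟩
    · rw [← φ.toInterval_val ht, ← φ.toInterval_val ht, h]
    · obtain ⟨x, hx⟩ := (φ.bijective t ht).2 y.1
      exact ⟨x, Subtype.ext ((φ.toInterval_val ht x).trans hx)⟩
  · have := φ.subsingleton t ht
    exact ⟨Function.injective_of_subsingleton _,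
      fun y => ⟨0, Subtype.ext (by rw [map_zero]; exact (y.2 ht).symm)⟩⟩

theorem toInterval_map (φ : A.IntervalCoordinate J) {s t : ℝ} (h : s ≤ t) (x : A.V s) :
    φ.toInterval t (A.map s t h x) = (intervalModule 𝕜 J).map s t h (φ.toInterval s x) := by
  by_cases ht : t ∈ J.carrier
  · apply Subtype.ext
    rw [φ.toInterval_val ht, intervalModule_map_val h ht]
    by_cases hs : s ∈ J.carrier
    · rw [φ.toInterval_val hs, φ.comm s t h hs ht]
    · have := φ.subsingleton s hs
      rw [Subsingleton.elim x 0, map_zero, map_zero, map_zero]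
      rfl
  · have := φ.subsingleton t ht
    rw [Subsingleton.elim (A.map s t h x) 0, map_zero, intervalModule_map_of_notMem h ht,
      LinearMap.zero_apply]

theorem isBarcode (φ : A.IntervalCoordinate J) : A.IsBarcode {J} := by
  have hbij : ∀ t, Function.Bijective
      (DFinsupp.lsingle (R := 𝕜) (M := fun _ : Fin 1 => (intervalModule 𝕜 J).V t) 0) := fun t => by
    refine ⟨DFinsupp.single_injective (β := fun _ : Fin 1 => (intervalModule 𝕜 J).V t),
      fun y => ⟨y 0, ?_⟩⟩
    ext i
    obtain rfl := Subsingleton.elim i 0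
    simp
  refine ⟨1, fun _ => J, rfl, ⟨⟨fun t => (LinearEquiv.ofBijective _ (φ.toInterval_bijective t)).trans
    (LinearEquiv.ofBijective _ (hbij t)), fun s t h x => ?_⟩⟩⟩
  change (DFinsupp.single 0 (φ.toInterval t (A.map s t h x)) :
    Π₀ _ : Fin 1, (intervalModule 𝕜 J).V t) = _
  rw [φ.toInterval_map]
  exact (directSum_map_single (fun _ : Fin 1 => intervalModule 𝕜 J) h 0 (φ.toInterval s x)).symm

/-- Comparing dimensions at each `t`, the bars lie in `J`, cover it and are pairwise disjoint.
Structure maps between points of `J` are injective, so a bar cannot end inside `J`; two bars in `J`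
would then overlap, and a single bar fills `J`. -/
theorem eq_singleton_of_isBarcode (φ : A.IntervalCoordinate J) {b : Multiset BarInterval}
    (hb : A.IsBarcode b) : b = {J} := by
  obtain ⟨m, I, rfl, ⟨Φ⟩⟩ := hb
  let g : ∀ (i : Fin m) (t : ℝ) (_ : t ∈ (I i).carrier), Π₀ i, (intervalModule 𝕜 (I i)).V t :=
    fun i t ht => DFinsupp.single i (intervalGenerator 𝕜 ht)
  have hg : ∀ i t ht, g i t ht ≠ 0 := fun i t ht =>
    single_intervalGenerator_ne_zero I i ht
  have hsub : ∀ i t, t ∈ (I i).carrier → t ∈ J.carrier := by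
    intro i t ht
    by_contra hJ
    have := φ.subsingleton t hJ
    exact hg i t ht ((Φ.equiv t).symm.injective.subsingleton.elim _ _)
  have hex : ∀ t ∈ J.carrier, ∃ i, t ∈ (I i).carrier := by
    intro t ht
    by_contra! h
    obtain ⟨x, hx⟩ := (φ.bijective t ht).2 1
    have hz : Φ.equiv t x = (0 : Π₀ i, (intervalModule 𝕜 (I i)).V t) := by
      refine DFinsupp.ext fun i => Subtype.ext ?_
      exact (DFunLike.coe (F := Π₀ i, (intervalModule 𝕜 (I i)).V t) (Φ.equiv t x) i).2 (h i)
    have hx0 : x = 0 := (Φ.equiv t).map_eq_zero_iff.1 hz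
    rw [hx0, map_zero] at hx
    exact zero_ne_one hx
  have huniq : ∀ i j t, t ∈ (I i).carrier → t ∈ (I j).carrier → i = j := by
    intro i j t hi hj
    by_contra hij
    set ψ : (Π₀ i, (intervalModule 𝕜 (I i)).V t) →ₗ[𝕜] 𝕜 :=
      (φ.coord t).comp (Φ.equiv t).symm.toLinearMap with hψ
    have hinj : Function.Injective ψ :=
      (φ.bijective t (hsub i t hi)).1.comp (Φ.equiv t).symm.injective
    -- Injectivity of the functional `ψ` makes any two vectors proportional; the `i`-th component of
    -- this relation forces `ψ` to kill the generator of bar `j`.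
    have h1 : ψ (g j t hj) • g i t hi = ψ (g i t hi) • g j t hj := hinj (by
      rw [map_smul, map_smul, smul_eq_mul, smul_eq_mul, mul_comm])
    have h2 := DFunLike.congr_fun h1 i
    rw [DFinsupp.smul_apply, DFinsupp.smul_apply, DFinsupp.single_eq_same,
      DFinsupp.single_eq_of_ne hij, smul_zero] at h2
    have h3 : ψ (g j t hj) = 0 := (mul_one _).symm.trans (congrArg Subtype.val h2)
    exact hg j t hj (hinj (h3.trans (map_zero ψ).symm))
  have hup : ∀ i s t, s ≤ t → t ∈ J.carrier → s ∈ (I i).carrier → t ∈ (I i).carrier := by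
    intro i s t hst ht hs
    by_contra hti
    have hx : Φ.equiv s ((Φ.equiv s).symm (g i s hs)) = g i s hs :=
      LinearEquiv.apply_symm_apply _ _
    have hz : (directSum fun i => intervalModule 𝕜 (I i)).map s t hst (g i s hs) = 0 := by
      refine (directSum_map_single _ hst i _).trans ?_
      rw [intervalModule_map_of_notMem hst hti, LinearMap.zero_apply]
      exact DFinsupp.single_zero i
    have h0 := (Φ.equiv t).map_eq_zero_iff.1
      ((Φ.comm s t hst ((Φ.equiv s).symm (g i s hs))).trans ((congrArg _ hx).trans hz))
    have h1 := φ.comm s t hst (hsub i s hs) ht ((Φ.equiv s).symm (g i s hs))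
    rw [h0, map_zero] at h1
    have h2 := (φ.bijective s (hsub i s hs)).1 (h1.symm.trans (map_zero _).symm)
    exact hg i s hs ((Φ.equiv s).symm.map_eq_zero_iff.1 h2)
  have hall : ∀ i, I i = J := by
    intro i
    refine BarInterval.ext (Set.Subset.antisymm (hsub i) fun s hs => ?_)
    obtain ⟨t, ht⟩ := (I i).nonempty
    rcases le_total t s with h | h
    · exact hup i t s h hs ht
    · obtain ⟨j, hj⟩ := hex s hs
      rwa [huniq i j t ht (hup j s t h (hsub i t ht) hj)]
  obtain ⟨t, ht⟩ := J.nonempty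
  obtain ⟨i, hi⟩ := hex t ht
  have huniv : (Finset.univ : Finset (Fin m)) = {i} :=
    Finset.eq_singleton_iff_unique_mem.2 ⟨Finset.mem_univ i, fun j _ =>
      huniq j i t (by rwa [hall j]) hi⟩
  rw [huniv, Finset.singleton_val, Multiset.map_singleton, hall i]

end IntervalCoordinate

/-- `barcode` is defined by choice, so it can be computed only where the barcode is unique. -/
theorem barcode_eq {A : PersistenceModule.{w} 𝕜} {b : Multiset BarInterval}
    (h : A.IsBarcode b) (h' : ∀ b', A.IsBarcode b' → b' = b) : A.barcode = b := by
  have hex : ∃ b, A.IsBarcode b := ⟨b, h⟩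
  rw [barcode, dif_pos hex]
  exact h' _ hex.choose_spec

end PersistenceModule

/-! ### First homology of complexes with at most three vertices -/

section SmallComplexes

universe u v

variable {𝕜 : Type u} [Field 𝕜] {V : Type v}

open Classical in
/-- The elementary chain of the oriented simplex `[x₀, …, xₙ₋₁]`. -/
noncomputable def elementaryChain (𝕜 : Type u) [Field 𝕜] {n : ℕ} (x : Fin n → V) :
    (Fin n → V) → 𝕜 :=
  fun y => ∑ σ : Equiv.Perm (Fin n), if y = x ∘ σ then ((Equiv.Perm.sign σ : ℤ) : 𝕜) else 0

theorem exists_of_elementaryChain_ne_zero {n : ℕ} {x y : Fin n → V}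
    (h : elementaryChain 𝕜 x y ≠ 0) : ∃ σ : Equiv.Perm (Fin n), y = x ∘ σ := by
  obtain ⟨σ, -, hσ⟩ := Finset.exists_ne_zero_of_sum_ne_zero h
  exact ⟨σ, by_contra fun h' => hσ (if_neg h')⟩

theorem elementaryChain_comp {n : ℕ} {x : Fin n → V} (hx : Function.Injective x)
    (ρ : Equiv.Perm (Fin n)) :
    elementaryChain 𝕜 x (x ∘ ρ) = ((Equiv.Perm.sign ρ : ℤ) : 𝕜) := by
  classical
  rw [elementaryChain, Finset.sum_eq_single ρ, if_pos rfl]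
  · intro σ _ hσ
    refine if_neg fun h => hσ ?_
    ext i
    exact congrArg Fin.val (hx (congrFun h i)).symm
  · exact fun h => absurd (Finset.mem_univ ρ) h

theorem elementaryChain_mem (K : PreAbstractSimplicialComplex V) {n : ℕ} {x : Fin n → V}
    (hx : Function.Injective x) {s : Finset V} (hs : s ∈ K) (hsx : (s : Set V) = Set.range x) :
    elementaryChain 𝕜 x ∈ simplicialChains 𝕜 K n := by
  classical
  refine ⟨(Set.finite_range fun σ : Equiv.Perm (Fin n) => x ∘ σ).subset fun y hy => ?_,
    fun y hy => ?_, fun y τ => ?_⟩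
  · obtain ⟨σ, rfl⟩ := exists_of_elementaryChain_ne_zero hy
    exact ⟨σ, rfl⟩
  · obtain ⟨σ, rfl⟩ := exists_of_elementaryChain_ne_zero hy
    exact ⟨hx.comp σ.injective, Or.inr ⟨s, hs, by rw [hsx, EquivLike.range_comp]⟩⟩
  · simp only [elementaryChain]
    -- Reindexing by `σ ↦ σ * τ` pulls the factor `sign τ` out of the sum.
    rw [← Equiv.sum_comp (Equiv.mulRight τ), Finset.mul_sum]
    refine Finset.sum_congr rfl fun σ _ => ?_
    have h : (y ∘ τ = x ∘ (Equiv.mulRight τ σ)) ↔ y = x ∘ σ := by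
      rw [Equiv.coe_mulRight, Equiv.Perm.coe_mul, ← Function.comp_assoc]
      exact τ.surjective.injective_comp_right.eq_iff
    by_cases h' : y = x ∘ σ
    · rw [if_pos (h.2 h'), if_pos h', Equiv.coe_mulRight, Equiv.Perm.sign_mul]
      push_cast
      ring
    · rw [if_neg (mt h.1 h'), if_neg h', mul_zero]

variable {K : PreAbstractSimplicialComplex V}

theorem chain_swap {c : (Fin 2 → V) → 𝕜} (hc : c ∈ simplicialChains 𝕜 K 2) (a b : V) :
    c ![b, a] = -c ![a, b] := by
  have h := hc.2.2 ![a, b] (Equiv.swap 0 1)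
  rw [Equiv.Perm.sign_swap (by simp)] at h
  have h' : ![a, b] ∘ (Equiv.swap (0 : Fin 2) 1) = ![b, a] := by
    ext i
    fin_cases i <;> simp
  rw [h'] at h
  simpa using h

theorem chain_diag {c : (Fin 2 → V) → 𝕜} (hc : c ∈ simplicialChains 𝕜 K 2) (a : V) :
    c ![a, a] = 0 := by
  by_contra h
  have := (hc.2.1 _ h).1 (a₁ := 0) (a₂ := 1) (by simp)
  simp at this

theorem exists_face_of_chain_ne_zero {c : (Fin 2 → V) → 𝕜} (hc : c ∈ simplicialChains 𝕜 K 2)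
    {a b : V} (h : c ![a, b] ≠ 0) : ∃ s ∈ K, (s : Set V) = {a, b} := by
  obtain ⟨-, h | ⟨s, hs, he⟩⟩ := hc.2.1 _ h
  · simp at h
  · exact ⟨s, hs, by rw [he, Matrix.range_cons_cons_empty]⟩

/-- A cycle satisfies the vanishing condition for the boundary at every vertex. -/
theorem sum_eq_zero_of_mem_ker {P : Finset V} (hK : ∀ s ∈ K, s ⊆ P)
    {c : simplicialChains 𝕜 K 2} (hc : c ∈ LinearMap.ker (simplicialBoundary 𝕜 K 1)) (b : V) :
    ∑ v ∈ P, c.1 ![v, b] = 0 := by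
  have h : ∑ᶠ v, c.1 (Fin.cons v ![b]) = 0 :=
    congrFun (congrArg Subtype.val (LinearMap.mem_ker.1 hc)) ![b]
  rwa [finsum_eq_sum_of_support_subset (s := P)] at h
  intro v hv
  obtain ⟨s, hs, he⟩ := exists_face_of_chain_ne_zero c.2 hv
  have hvs : v ∈ s := by
    rw [← Finset.mem_coe, he]
    simp
  exact hK s hs hvs

theorem chain_eq_zero {P : Finset V} (hK : ∀ s ∈ K, s ⊆ P) {c : simplicialChains 𝕜 K 2}
    (h : ∀ a ∈ P, ∀ b ∈ P, a ≠ b → c.1 ![a, b] = 0) : c = 0 := by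
  apply Subtype.ext
  funext y
  by_contra hy
  have hy' : y = ![y 0, y 1] := by
    ext i
    fin_cases i <;> rfl
  rw [hy'] at hy
  obtain ⟨s, hs, he⟩ := exists_face_of_chain_ne_zero c.2 hy
  have h0 : y 0 ∈ s := by
    rw [← Finset.mem_coe, he]
    simp
  have h1 : y 1 ∈ s := by
    rw [← Finset.mem_coe, he]
    simp
  refine hy (h _ (hK s hs h0) _ (hK s hs h1) fun e => hy ?_)
  rw [e]
  exact chain_diag c.2 _

theorem subsingleton_homology_of_ker {k : ℕ}
    (h : ∀ c ∈ LinearMap.ker (simplicialBoundary 𝕜 K k),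
      c ∈ LinearMap.range (simplicialBoundary 𝕜 K (k + 1))) :
    Subsingleton (ReducedHomology 𝕜 K k) := by
  exact Submodule.Quotient.subsingleton_iff.2 (eq_top_iff.2 fun c _ => h c.1 c.2)

/-- On at most one edge, the boundary at an endpoint is the coefficient of that edge, so every cycle
vanishes. -/
theorem subsingleton_homology_one_of_card_le_two {P : Finset V} (hK : ∀ s ∈ K, s ⊆ P)
    (hP : P.card ≤ 2) : Subsingleton (ReducedHomology 𝕜 K 1) := by
  classical
  refine subsingleton_homology_of_ker fun c hc => ?_
  rw [chain_eq_zero hK (c := c)]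
  · exact Submodule.zero_mem _
  intro a ha b hb hab
  have hP' : P = {a, b} := by
    refine (Finset.eq_of_subset_of_card_le ?_ ?_).symm
    · simp [Finset.insert_subset_iff, ha, hb]
    · rwa [Finset.card_pair hab]
  have h := sum_eq_zero_of_mem_ker hK hc b
  rwa [hP', Finset.sum_pair hab, chain_diag c.2, add_zero] at h

theorem injective_triple {a b d : V} (hab : a ≠ b) (had : a ≠ d) (hbd : b ≠ d) :
    Function.Injective ![a, b, d] := by
  intro i j h
  fin_cases i <;> fin_cases j <;> simp_all

section Triangle

variable [DecidableEq V] {a b d : V}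

/-- The boundary equations at two vertices and antisymmetry force one common coefficient around the
triangle. Hence a cycle is determined by its value at `![a, b]`, the coordinate used from here on.
-/
theorem cycle_values (hab : a ≠ b) (had : a ≠ d) (hbd : b ≠ d)
    (hK : ∀ s ∈ K, s ⊆ ({a, b, d} : Finset V)) {c : simplicialChains 𝕜 K 2}
    (hc : c ∈ LinearMap.ker (simplicialBoundary 𝕜 K 1)) :
    c.1 ![b, d] = c.1 ![a, b] ∧ c.1 ![d, a] = c.1 ![a, b] := by
  have key : ∀ v, c.1 ![a, v] + (c.1 ![b, v] + c.1 ![d, v]) = 0 := fun v => by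
    have h := sum_eq_zero_of_mem_ker hK hc v
    rwa [Finset.sum_insert (by simp [hab, had]), Finset.sum_pair hbd] at h
  have h1 := key b
  have h2 := key d
  rw [chain_diag c.2, chain_swap c.2 b d] at h1
  rw [chain_diag c.2, chain_swap c.2 d a] at h2
  constructor
  · linear_combination -h1
  · linear_combination -h1 - h2

theorem cycle_eq_zero (hab : a ≠ b) (had : a ≠ d) (hbd : b ≠ d)
    (hK : ∀ s ∈ K, s ⊆ ({a, b, d} : Finset V)) {c : simplicialChains 𝕜 K 2}
    (hc : c ∈ LinearMap.ker (simplicialBoundary 𝕜 K 1)) (h0 : c.1 ![a, b] = 0) : c = 0 := by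
  obtain ⟨h1, h2⟩ := cycle_values hab had hbd hK hc
  rw [h0] at h1 h2
  refine chain_eq_zero hK fun v hv w hw hvw => ?_
  simp only [Finset.mem_insert, Finset.mem_singleton] at hv hw
  rcases hv with rfl | rfl | rfl <;> rcases hw with rfl | rfl | rfl <;>
    first
    | exact absurd rfl hvw
    | assumption
    | (rw [chain_swap c.2, neg_eq_zero]; assumption)

theorem subsingleton_homology_one_of_edge_notMem (hab : a ≠ b) (had : a ≠ d) (hbd : b ≠ d)
    (hK : ∀ s ∈ K, s ⊆ ({a, b, d} : Finset V))
    (h : {a, b} ∉ K ∨ {b, d} ∉ K ∨ {d, a} ∉ K) : Subsingleton (ReducedHomology 𝕜 K 1) := by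
  refine subsingleton_homology_of_ker fun c hc => ?_
  have key : ∀ v w : V, ({v, w} : Finset V) ∉ K → c.1 ![v, w] = 0 := by
    intro v w hvw
    by_contra hne
    obtain ⟨s, hs, he⟩ := exists_face_of_chain_ne_zero c.2 hne
    refine hvw ?_
    rwa [show ({v, w} : Finset V) = s from Finset.coe_injective (by simp [he])]
  obtain ⟨h1, h2⟩ := cycle_values hab had hbd hK hc
  rw [cycle_eq_zero hab had hbd hK hc]
  · exact Submodule.zero_mem _
  · rcases h with h | h | h
    · exact key _ _ h
    · rw [← h1, key _ _ h]
    · rw [← h2, key _ _ h]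

theorem coe_triple_eq_range (a b d : V) :
    (({a, b, d} : Finset V) : Set V) = Set.range ![a, b, d] := by
  ext v
  simp [eq_comm, or_comm, or_left_comm]

/-- The boundary of the elementary chain of a triangle takes the value `1` on its first edge. -/
theorem boundary_elementaryChain_triangle (hab : a ≠ b) (had : a ≠ d) (hbd : b ≠ d) :
    ∑ᶠ v, elementaryChain 𝕜 ![a, b, d] (Fin.cons v ![a, b]) = 1 := by
  have hx := injective_triple hab had hbd
  rw [finsum_eq_single _ d]
  · have : (Fin.cons d ![a, b] : Fin 3 → V) = ![a, b, d] ∘ ((finRotate 3)⁻¹ : Equiv.Perm (Fin 3)) := by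
      ext i
      fin_cases i <;> rfl
    rw [this, elementaryChain_comp hx, Equiv.Perm.sign_inv, sign_finRotate]
    simp
  -- A nonzero summand needs a vertex of the triangle different from `a` and `b`, which can only be
  -- `d`.
  · intro v hv
    by_contra hne
    obtain ⟨σ, hσ⟩ := exists_of_elementaryChain_ne_zero hne
    have hinj : Function.Injective (Fin.cons v ![a, b] : Fin 3 → V) := by
      rw [hσ]
      exact hx.comp σ.injective
    have hva : v ≠ a := fun h => by
      have := hinj (a₁ := 0) (a₂ := 1) (by simpa using h)
      simp at this
    have hvb : v ≠ b := fun h => by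
      have := hinj (a₁ := 0) (a₂ := 2) (by simpa using h)
      simp at this
    have hmem : v ∈ Set.range ![a, b, d] := ⟨σ 0, (congrFun hσ 0).symm⟩
    rw [← coe_triple_eq_range] at hmem
    simp [hva, hvb, hv] at hmem

/-- Subtracting from `c` the multiple `c ![a, b]` of the boundary of the triangle leaves a cycle
that vanishes on the edge `![a, b]`, hence zero. -/
theorem subsingleton_homology_one_of_triangle_mem (hab : a ≠ b) (had : a ≠ d) (hbd : b ≠ d)
    (hK : ∀ s ∈ K, s ⊆ ({a, b, d} : Finset V)) (h : {a, b, d} ∈ K) :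
    Subsingleton (ReducedHomology 𝕜 K 1) := by
  refine subsingleton_homology_of_ker fun c hc => ?_
  let T : simplicialChains 𝕜 K 3 := ⟨elementaryChain 𝕜 ![a, b, d],
    elementaryChain_mem K (injective_triple hab had hbd) h (coe_triple_eq_range a b d)⟩
  have hT : (simplicialBoundary 𝕜 K 2 T).1 ![a, b] = 1 :=
    boundary_elementaryChain_triangle hab had hbd
  refine ⟨c.1 ![a, b] • T, ?_⟩
  rw [map_smul, eq_comm, ← sub_eq_zero]
  refine cycle_eq_zero hab had hbd hK ?_ ?_
  · refine Submodule.sub_mem _ hc (Submodule.smul_mem _ _ ?_)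
    exact simplicialBoundary_boundary 𝕜 K 1 T
  · change c.1 ![a, b] - c.1 ![a, b] * (simplicialBoundary 𝕜 K 2 T).1 ![a, b] = 0
    rw [hT, mul_one, sub_self]

/-- The boundary of a triangle is a cycle in every complex that contains its edges. -/
theorem exists_cycle_of_edges_mem (hab : a ≠ b) (had : a ≠ d) (hbd : b ≠ d)
    (h1 : {a, b} ∈ K) (h2 : {b, d} ∈ K) (h3 : {d, a} ∈ K) :
    ∃ c ∈ LinearMap.ker (simplicialBoundary 𝕜 K 1), c.1 ![a, b] = 1 := by
  -- The cycle is the boundary of the triangle taken in the full complex, where `∂ ∘ ∂ = 0` applies;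
  -- only its edges are needed to see that it lies in `K`.
  let L : PreAbstractSimplicialComplex V := ⊤
  have hL : ({a, b, d} : Finset V) ∈ L := Finset.insert_nonempty _ _
  let T : simplicialChains 𝕜 L 3 := ⟨elementaryChain 𝕜 ![a, b, d],
    elementaryChain_mem L (injective_triple hab had hbd) hL (coe_triple_eq_range a b d)⟩
  have hT : (simplicialBoundary 𝕜 L 2 T).1 ![a, b] = 1 :=
    boundary_elementaryChain_triangle hab had hbd
  have hmem : (simplicialBoundary 𝕜 L 2 T).1 ∈ simplicialChains 𝕜 K 2 := by
    obtain ⟨hf, hi, hs⟩ := (simplicialBoundary 𝕜 L 2 T).2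
    refine ⟨hf, fun y hy => ⟨(hi y hy).1, Or.inr ?_⟩, hs⟩
    have hv : ∃ v, elementaryChain 𝕜 ![a, b, d] (Fin.cons v y) ≠ 0 := by
      by_contra! hz
      exact hy ((finsum_congr hz).trans finsum_zero)
    obtain ⟨v, hv⟩ := hv
    obtain ⟨σ, hσ⟩ := exists_of_elementaryChain_ne_zero hv
    have hr : ∀ i, y i ∈ ({a, b, d} : Finset V) := fun i => by
      rw [← Finset.mem_coe, coe_triple_eq_range]
      exact ⟨σ i.succ, by simpa using (congrFun hσ i.succ).symm⟩
    have hne : y 0 ≠ y 1 := fun e => by simpa using (hi y hy).1 e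
    refine ⟨{y 0, y 1}, ?_, ?_⟩
    · have h0 := hr 0
      have h1' := hr 1
      simp only [Finset.mem_insert, Finset.mem_singleton] at h0 h1'
      rcases h0 with e | e | e <;> rcases h1' with e' | e' | e' <;> rw [e, e'] at hne ⊢ <;>
        first
        | exact absurd rfl hne
        | assumption
        | (rw [Finset.pair_comm]; assumption)
    · ext w
      simp [Fin.exists_fin_two, eq_comm]
  refine ⟨⟨_, hmem⟩, ?_, hT⟩
  have h := congrArg Subtype.val (simplicialBoundary_boundary 𝕜 L 1 T)
  exact Subtype.ext h

/-- If the complex contains no triangle then a class in `H₁` is determined by its coefficient at an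
edge. -/
theorem exists_coord_homology_one (hab : a ≠ b) (had : a ≠ d) (hbd : b ≠ d)
    (hK : ∀ s ∈ K, s ⊆ ({a, b, d} : Finset V)) (h1 : {a, b} ∈ K) (h2 : {b, d} ∈ K)
    (h3 : {d, a} ∈ K) (h : {a, b, d} ∉ K) :
    ∃ φ : ReducedHomology 𝕜 K 1 →ₗ[𝕜] 𝕜, Function.Bijective φ ∧
      ∀ c : LinearMap.ker (simplicialBoundary 𝕜 K 1), φ (Submodule.Quotient.mk c) =
        c.1.1 ![a, b] := by
  -- Without the triangle there are no chains on three vertices, so no boundaries are divided out.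
  have hzero : ∀ T : simplicialChains 𝕜 K 3, T = 0 := by
    intro T
    apply Subtype.ext
    funext y
    by_contra hy
    obtain ⟨hinj, h0 | ⟨s, hs, he⟩⟩ := T.2.2.1 y hy
    · simp at h0
    · have hcard : s.card = 3 := by
        rw [← Set.ncard_coe_finset, he, ← Set.image_univ, Set.ncard_image_of_injective _ hinj]
        simp
      have : s = {a, b, d} := Finset.eq_of_subset_of_card_le (hK s hs)
        (Finset.card_le_three.trans hcard.ge)
      exact h (this ▸ hs)
  let ev : LinearMap.ker (simplicialBoundary 𝕜 K 1) →ₗ[𝕜] 𝕜 :=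
    { toFun := fun c => c.1.1 ![a, b]
      map_add' := fun _ _ => rfl
      map_smul' := fun _ _ => rfl }
  refine ⟨Submodule.liftQ _ ev ?_, ⟨?_, ?_⟩, fun c => rfl⟩
  · rintro c ⟨T, hT⟩
    rw [hzero T, map_zero] at hT
    have : c = 0 := Subtype.ext hT.symm
    rw [this]
    exact Submodule.zero_mem _
  · rw [injective_iff_map_eq_zero]
    intro x hx
    obtain ⟨c, rfl⟩ := Submodule.Quotient.mk_surjective _ x
    have : c = 0 := Subtype.ext (cycle_eq_zero hab had hbd hK c.2 hx)
    rw [this, Submodule.Quotient.mk_zero]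
  · intro r
    obtain ⟨c, hc, hc1⟩ := exists_cycle_of_edges_mem (𝕜 := 𝕜) hab had hbd h1 h2 h3
    refine ⟨Submodule.Quotient.mk (r • ⟨c, hc⟩), ?_⟩
    change r * c.1 ![a, b] = r
    rw [hc1, mul_one]

end Triangle

end SmallComplexes

/-! ### Čech complexes of triangles inscribed in the unit circle -/

section InscribedTriangles

open scoped RealInnerProductSpace

/-- The triangle `p q r` is acute (in particular it is not degenerate). -/
def IsAcute (p q r : Plane) : Prop :=
  0 < ⟪q - p, r - p⟫ ∧ 0 < ⟪r - q, p - q⟫ ∧ 0 < ⟪p - r, q - r⟫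

/-- The length of the longest side of the triangle `p q r`. -/
noncomputable def longestSide (p q r : Plane) : ℝ :=
  max (dist p q) (max (dist q r) (dist r p))

open Classical in
/-- The length of the bar in degree one of a triangle inscribed in the unit circle. -/
noncomputable def triangleBarLength (p q r : Plane) : ℝ :=
  if IsAcute p q r then 1 - longestSide p q r / 2 else 0

theorem IsAcute.rotate {p q r : Plane} (h : IsAcute p q r) : IsAcute q r p :=
  ⟨h.2.1, h.2.2, h.1⟩

theorem IsAcute.ne {p q r : Plane} (h : IsAcute p q r) : p ≠ q := by
  rintro rfl
  simpa using h.1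

theorem inner_sub_sub_eq (p q r : Plane) :
    ⟪q - p, r - p⟫ = (q 0 - p 0) * (r 0 - p 0) + (q 1 - p 1) * (r 1 - p 1) := by
  rw [PiLp.inner_apply, Fin.sum_univ_two]
  simp [mul_comm]

theorem sq_add_sq_of_norm_eq_one {p : Plane} (hp : ‖p‖ = 1) : p 0 ^ 2 + p 1 ^ 2 = 1 := by
  have := EuclideanSpace.real_norm_sq_eq p
  rw [hp, Fin.sum_univ_two] at this
  linarith

theorem longestSide_nonneg (p q r : Plane) : 0 ≤ longestSide p q r :=
  dist_nonneg.trans (le_max_left _ _)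

theorem longestSide_le_iff {p q r : Plane} {s : ℝ} :
    longestSide p q r ≤ s ↔ dist p q ≤ s ∧ dist q r ≤ s ∧ dist r p ≤ s := by
  rw [longestSide, max_le_iff, max_le_iff]

theorem mem_cechComplex_iff {P s : Finset Plane} {t : ℝ} :
    s ∈ cechComplex P t ↔ s.Nonempty ∧ s ⊆ P ∧ ∃ z, ∀ x ∈ s, dist z x ≤ t := by
  change (s.Nonempty ∧ s ⊆ P ∧ (⋂ x ∈ s, Metric.closedBall x t).Nonempty) ↔ _
  simp [Set.Nonempty]

/-- Barycentric weights of the circumcenter: the squared side times the inner product at the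
opposite vertex. For vertices on the unit circle the circumcenter is the origin. -/
theorem circumcenter_weights_identity {p₀ p₁ q₀ q₁ r₀ r₁ : ℝ} (hp : p₀ ^ 2 + p₁ ^ 2 = 1)
    (hq : q₀ ^ 2 + q₁ ^ 2 = 1) (hr : r₀ ^ 2 + r₁ ^ 2 = 1) :
    ((q₀ - r₀) ^ 2 + (q₁ - r₁) ^ 2) * ((q₀ - p₀) * (r₀ - p₀) + (q₁ - p₁) * (r₁ - p₁)) * p₀ +
      ((r₀ - p₀) ^ 2 + (r₁ - p₁) ^ 2) * ((r₀ - q₀) * (p₀ - q₀) + (r₁ - q₁) * (p₁ - q₁)) * q₀ +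
      ((p₀ - q₀) ^ 2 + (p₁ - q₁) ^ 2) * ((p₀ - r₀) * (q₀ - r₀) + (p₁ - r₁) * (q₁ - r₁)) * r₀ = 0 ∧
    ((q₀ - r₀) ^ 2 + (q₁ - r₁) ^ 2) * ((q₀ - p₀) * (r₀ - p₀) + (q₁ - p₁) * (r₁ - p₁)) * p₁ +
      ((r₀ - p₀) ^ 2 + (r₁ - p₁) ^ 2) * ((r₀ - q₀) * (p₀ - q₀) + (r₁ - q₁) * (p₁ - q₁)) * q₁ +
      ((p₀ - q₀) ^ 2 + (p₁ - q₁) ^ 2) * ((p₀ - r₀) * (q₀ - r₀) + (p₁ - r₁) * (q₁ - r₁)) * r₁ = 0 := by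
  constructor <;> grind

/-- The circumcenter of an acute triangle is a positive combination of the vertices. -/
theorem IsAcute.exists_weights {p q r : Plane} (h : IsAcute p q r) (hp : ‖p‖ = 1) (hq : ‖q‖ = 1)
    (hr : ‖r‖ = 1) : ∃ a b c : ℝ, 0 < a ∧ 0 < b ∧ 0 < c ∧ a • p + b • q + c • r = 0 := by
  have hp' := sq_add_sq_of_norm_eq_one hp
  have hq' := sq_add_sq_of_norm_eq_one hq
  have hr' := sq_add_sq_of_norm_eq_one hr
  have hw : ∀ {x y : Plane}, x ≠ y → 0 < ‖x - y‖ ^ 2 := fun hxy =>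
    pow_pos (norm_pos_iff.2 (sub_ne_zero.2 hxy)) 2
  refine ⟨‖q - r‖ ^ 2 * ⟪q - p, r - p⟫, ‖r - p‖ ^ 2 * ⟪r - q, p - q⟫, ‖p - q‖ ^ 2 * ⟪p - r, q - r⟫,
    mul_pos (hw h.rotate.ne) h.1, mul_pos (hw h.rotate.rotate.ne) h.2.1, mul_pos (hw h.ne) h.2.2, ?_⟩
  simp only [inner_sub_sub_eq, EuclideanSpace.real_norm_sq_eq, Fin.sum_univ_two]
  ext i
  fin_cases i
  · exact (circumcenter_weights_identity hp' hq' hr').1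
  · exact (circumcenter_weights_identity hp' hq' hr').2

/-- Thales: if `p` and `q` were antipodal, the angle at `r` would be right. -/
theorem IsAcute.dist_lt_two {p q r : Plane} (h : IsAcute p q r) (hp : ‖p‖ = 1) (hq : ‖q‖ = 1)
    (hr : ‖r‖ = 1) : dist p q < 2 := by
  have h1 : dist p q ≤ 2 := by
    have := norm_sub_le p q
    rw [hp, hq] at this
    rw [dist_eq_norm]
    linarith
  refine lt_of_le_of_ne h1 fun h2 => ?_
  have hp' := sq_add_sq_of_norm_eq_one hp
  have hq' := sq_add_sq_of_norm_eq_one hq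
  have hr' := sq_add_sq_of_norm_eq_one hr
  have h3 : ‖p - q‖ ^ 2 = 4 := by
    rw [← dist_eq_norm, h2]
    norm_num
  rw [EuclideanSpace.real_norm_sq_eq, Fin.sum_univ_two] at h3
  simp only [PiLp.sub_apply] at h3
  have h4 : (p 0 + q 0) ^ 2 + (p 1 + q 1) ^ 2 = 0 := by linear_combination 2 * hp' + 2 * hq' - h3
  have h5 : p 0 + q 0 = 0 := by nlinarith [sq_nonneg (p 0 + q 0), sq_nonneg (p 1 + q 1)]
  have h6 : p 1 + q 1 = 0 := by nlinarith [sq_nonneg (p 0 + q 0), sq_nonneg (p 1 + q 1)]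
  have h7 := h.2.2
  rw [inner_sub_sub_eq, eq_neg_of_add_eq_zero_left h5, eq_neg_of_add_eq_zero_left h6] at h7
  linarith

theorem IsAcute.longestSide_lt_two {p q r : Plane} (h : IsAcute p q r) (hp : ‖p‖ = 1)
    (hq : ‖q‖ = 1) (hr : ‖r‖ = 1) : longestSide p q r < 2 :=
  max_lt (h.dist_lt_two hp hq hr) (max_lt (h.rotate.dist_lt_two hq hr hp)
    (h.rotate.rotate.dist_lt_two hr hp hq))

theorem cechComplex_subset {P : Finset Plane} {t : ℝ} : ∀ s ∈ cechComplex P t, s ⊆ P :=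
  fun _ hs => (mem_cechComplex_iff.1 hs).2.1

variable [DecidableEq Plane]

theorem pair_mem_cechComplex_iff {P : Finset Plane} {p q : Plane} (hp : p ∈ P) (hq : q ∈ P)
    {t : ℝ} : {p, q} ∈ cechComplex P t ↔ dist p q ≤ 2 * t := by
  rw [mem_cechComplex_iff]
  constructor
  · rintro ⟨-, -, z, hz⟩
    have h1 := hz p (by simp)
    have h2 := hz q (by simp)
    have := dist_triangle_left p q z
    linarith
  · intro h
    refine ⟨Finset.insert_nonempty _ _, by simp [Finset.insert_subset_iff, hp, hq],
      midpoint ℝ p q, ?_⟩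
    simp only [Finset.mem_insert, Finset.mem_singleton]
    rintro x (rfl | rfl)
    · rw [dist_midpoint_left, Real.norm_two]
      linarith
    · rw [dist_midpoint_right, Real.norm_two]
      linarith

/-- The closed disk over a side of a triangle contains the opposite vertex if the angle there is not
acute. -/
theorem triple_mem_cechComplex_of_inner_nonpos {P : Finset Plane} {p q r : Plane}
    (hP : {p, q, r} ⊆ P) (h : ⟪q - p, r - p⟫ ≤ 0) {t : ℝ} (ht : dist q r ≤ 2 * t) :
    {p, q, r} ∈ cechComplex P t := by
  rw [mem_cechComplex_iff]
  refine ⟨Finset.insert_nonempty _ _, hP, midpoint ℝ q r, ?_⟩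
  simp only [Finset.mem_insert, Finset.mem_singleton]
  rintro x (rfl | rfl | rfl)
  · have h1 : midpoint ℝ q r - x = (2⁻¹ : ℝ) • ((q - x) + (r - x)) := by
      rw [midpoint_eq_smul_add, invOf_eq_inv]
      module
    -- A nonpositive inner product makes the norm of the sum at most that of the difference, so the
    -- median from `p` is at most half of the side `q r`.
    have h2 : ‖(q - x) + (r - x)‖ ≤ ‖q - r‖ := by
      refine (sq_le_sq₀ (norm_nonneg _) (norm_nonneg _)).1 ?_
      have h3 : q - r = (q - x) - (r - x) := by abel
      have h4 := norm_add_sq_real (q - x) (r - x)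
      have h5 := norm_sub_sq_real (q - x) (r - x)
      rw [h3]
      linarith
    rw [dist_eq_norm, h1, norm_smul, Real.norm_of_nonneg (by norm_num)]
    rw [dist_eq_norm] at ht
    linarith
  · rw [dist_midpoint_left, Real.norm_two]
    linarith
  · rw [dist_midpoint_right, Real.norm_two]
    linarith

/-- If `z` is within `t` of the vertices, then `‖z‖² - 2⟪z, x⟫ + 1 ≤ t²` for each vertex `x`.
Averaging with the positive circumcenter weights removes the linear term, so `1 ≤ t²`. Conversely,
the origin serves as common point. -/
theorem IsAcute.triple_mem_cechComplex_iff {P : Finset Plane} {p q r : Plane} (h : IsAcute p q r)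
    (hp : ‖p‖ = 1) (hq : ‖q‖ = 1) (hr : ‖r‖ = 1) (hP : {p, q, r} ⊆ P) {t : ℝ} :
    {p, q, r} ∈ cechComplex P t ↔ 1 ≤ t := by
  rw [mem_cechComplex_iff]
  constructor
  · rintro ⟨-, -, z, hz⟩
    obtain ⟨a, b, c, ha, hb, hc, habc⟩ := h.exists_weights hp hq hr
    have h1 : ∀ x ∈ ({p, q, r} : Finset Plane), ‖x‖ = 1 → ‖z‖ ^ 2 - 2 * ⟪z, x⟫ + 1 ≤ t ^ 2 := by
      intro x hx hx1
      have := pow_le_pow_left₀ dist_nonneg (hz x hx) 2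
      rwa [dist_eq_norm, norm_sub_sq_real, hx1, one_pow] at this
    have h2 := mul_le_mul_of_nonneg_left (h1 p (by simp) hp) ha.le
    have h3 := mul_le_mul_of_nonneg_left (h1 q (by simp) hq) hb.le
    have h4 := mul_le_mul_of_nonneg_left (h1 r (by simp) hr) hc.le
    have h5 : a * ⟪z, p⟫ + b * ⟪z, q⟫ + c * ⟪z, r⟫ = 0 := by
      rw [← real_inner_smul_right, ← real_inner_smul_right, ← real_inner_smul_right,
        ← inner_add_right, ← inner_add_right, habc, inner_zero_right]
    have h6 : (a + b + c) * 1 ≤ (a + b + c) * t ^ 2 := by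
      have := mul_nonneg (add_pos (add_pos ha hb) hc).le (sq_nonneg ‖z‖)
      linarith
    have h7 := le_of_mul_le_mul_left h6 (by positivity)
    have h8 : 0 ≤ t := dist_nonneg.trans (hz p (by simp))
    nlinarith
  · intro ht
    refine ⟨Finset.insert_nonempty _ _, hP, 0, ?_⟩
    simp only [Finset.mem_insert, Finset.mem_singleton]
    rintro x (rfl | rfl | rfl) <;> simp [*]

/-- The bar in degree one of an acute triangle inscribed in the unit circle. -/
def triangleBar (p q r : Plane) (h : longestSide p q r < 2) : BarInterval where
  carrier := Set.Ico (longestSide p q r / 2) 1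
  nonempty := Set.nonempty_Ico.2 (by linarith)
  ordConnected := Set.ordConnected_Ico

variable {𝕜 : Type*} [Field 𝕜]

/-- Either an edge is missing, or the disk over the side opposite a non-acute angle already fills
the triangle. Coinciding points leave at most two vertices. -/
theorem subsingleton_persistentHomology_of_not_isAcute {p q r : Plane} (h : ¬ IsAcute p q r)
    (t : ℝ) : Subsingleton ((persistentHomology 𝕜 1 ({p, q, r} : Finset Plane)).V t) := by
  change Subsingleton (ReducedHomology 𝕜 (cechComplex {p, q, r} t) 1)
  by_cases hd : p ≠ q ∧ p ≠ r ∧ q ≠ r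
  · obtain ⟨hpq, hpr, hqr⟩ := hd
    by_cases he : dist p q ≤ 2 * t ∧ dist q r ≤ 2 * t ∧ dist r p ≤ 2 * t
    · refine subsingleton_homology_one_of_triangle_mem hpq hpr hqr cechComplex_subset ?_
      have hrot : ({p, q, r} : Finset Plane) = {q, r, p} := by
        ext x
        simp [or_comm, or_left_comm]
      have hrot' : ({p, q, r} : Finset Plane) = {r, p, q} := by
        ext x
        simp [or_comm, or_left_comm]
      rw [IsAcute, not_and_or, not_and_or, not_lt, not_lt, not_lt] at h
      rcases h with h | h | h
      · exact triple_mem_cechComplex_of_inner_nonpos subset_rfl h he.2.1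
      · have := triple_mem_cechComplex_of_inner_nonpos hrot.ge h he.2.2
        rwa [← hrot] at this
      · have := triple_mem_cechComplex_of_inner_nonpos hrot'.ge h he.1
        rwa [← hrot'] at this
    · refine subsingleton_homology_one_of_edge_notMem hpq hpr hqr cechComplex_subset ?_
      rw [pair_mem_cechComplex_iff (by simp) (by simp),
        pair_mem_cechComplex_iff (by simp) (by simp), pair_mem_cechComplex_iff (by simp) (by simp)]
      tauto
  · refine subsingleton_homology_one_of_card_le_two cechComplex_subset ?_
    have hsub : ∀ x y, ({p, q, r} : Finset Plane) ⊆ {x, y} →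
        ({p, q, r} : Finset Plane).card ≤ 2 := fun x y h =>
      (Finset.card_le_card h).trans Finset.card_le_two
    by_cases hpq : p = q
    · exact hsub q r (by simp [hpq])
    by_cases hpr : p = r
    · exact hsub q r (by simp [hpr])
    by_cases hqr : q = r
    · exact hsub p r (by simp [hqr])
    exact absurd ⟨hpq, hpr, hqr⟩ hd

/-- The coordinate of a class is the coefficient of a representing cycle at the edge `p q`.
Inclusions of complexes do not change it, whence the compatibility with the structure maps. -/
theorem IsAcute.exists_intervalCoordinate {p q r : Plane} (h : IsAcute p q r) (hp : ‖p‖ = 1)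
    (hq : ‖q‖ = 1) (hr : ‖r‖ = 1) :
    Nonempty ((persistentHomology 𝕜 1 ({p, q, r} : Finset Plane)).IntervalCoordinate
      (triangleBar p q r (h.longestSide_lt_two hp hq hr))) := by
  have hpq := h.ne
  have hqr := h.rotate.ne
  have hpr := h.rotate.rotate.ne.symm
  have hedge : ∀ t, longestSide p q r / 2 ≤ t ↔ {p, q} ∈ cechComplex ({p, q, r} : Finset Plane) t ∧
      {q, r} ∈ cechComplex ({p, q, r} : Finset Plane) t ∧
      {r, p} ∈ cechComplex ({p, q, r} : Finset Plane) t := fun t => by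
    rw [pair_mem_cechComplex_iff (by simp) (by simp), pair_mem_cechComplex_iff (by simp) (by simp),
      pair_mem_cechComplex_iff (by simp) (by simp), ← longestSide_le_iff, div_le_iff₀' two_pos]
  have htri : ∀ t, {p, q, r} ∈ cechComplex ({p, q, r} : Finset Plane) t ↔ 1 ≤ t := fun t =>
    h.triple_mem_cechComplex_iff hp hq hr subset_rfl
  -- Outside the bar the coordinate is set to `0`; nothing is required of it there.
  have key : ∀ t, ∃ φ : ReducedHomology 𝕜 (cechComplex ({p, q, r} : Finset Plane) t) 1 →ₗ[𝕜] 𝕜,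
      t ∈ Set.Ico (longestSide p q r / 2) 1 → Function.Bijective φ ∧
      ∀ c : LinearMap.ker (simplicialBoundary 𝕜 (cechComplex ({p, q, r} : Finset Plane) t) 1),
        φ (Submodule.Quotient.mk c) = c.1.1 ![p, q] := by
    intro t
    by_cases ht : t ∈ Set.Ico (longestSide p q r / 2) 1
    · obtain ⟨h1, h2, h3⟩ := (hedge t).1 ht.1
      obtain ⟨φ, hφ⟩ := exists_coord_homology_one (𝕜 := 𝕜) hpq hpr hqr cechComplex_subset h1 h2 h3
        (mt (htri t).1 (not_le.2 ht.2))
      exact ⟨φ, fun _ => hφ⟩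
    · exact ⟨0, fun h => absurd h ht⟩
  choose φ hφ using key
  refine ⟨⟨φ, fun t ht => ?_, fun t ht => (hφ t ht).1, fun s t hst hs ht x => ?_⟩⟩
  · change Subsingleton (ReducedHomology 𝕜 (cechComplex {p, q, r} t) 1)
    by_cases h1 : 1 ≤ t
    · exact subsingleton_homology_one_of_triangle_mem hpq hpr hqr cechComplex_subset ((htri t).2 h1)
    · refine subsingleton_homology_one_of_edge_notMem hpq hpr hqr cechComplex_subset ?_
      have : ¬ longestSide p q r / 2 ≤ t := fun h2 => ht ⟨h2, not_le.1 h1⟩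
      rw [hedge] at this
      tauto
  · obtain ⟨c, rfl⟩ := Submodule.Quotient.mk_surjective _ x
    exact ((hφ t ht).2 _).trans ((hφ s hs).2 c).symm

end InscribedTriangles

/-! ### Barcode and bar length of three points on the circle -/

section BarcodeOfTriangle

variable {𝕜 : Type*} [Field 𝕜]

theorem pointCloud_eq [DecidableEq Plane] (x : Fin 3 → UnitCircle) :
    pointCloud x = {(x 0 : Plane), (x 1 : Plane), (x 2 : Plane)} := by
  ext p
  simp [pointCloud, Fin.exists_fin_succ, eq_comm]

theorem BarcodeSpace.length_barcodeRepresentation_zero :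
    (barcodeRepresentation 0).length = 0 := by
  simp [BarcodeSpace.length, barcodeRepresentation]

theorem BarcodeSpace.length_barcodeRepresentation_singleton (I : BarInterval) :
    (barcodeRepresentation {I}).length = max (sSup I.carrier - sInf I.carrier) 0 := by
  classical
  change (((Multiset.map _ (Multiset.filter _ (Multiset.map _ {I}))).sum : NNReal) : ℝ) = _
  rw [Multiset.map_singleton, Multiset.filter_singleton]
  by_cases h : (sSup I.carrier - sInf I.carrier).toNNReal = 0
  · rw [if_neg (by simpa using h)]
    simp [Real.toNNReal_eq_zero.1 h]
  · rw [if_pos (by simpa using h)]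
    simp

/-- The barcode in degree one of three points on the unit circle. -/
theorem exists_barcode_pointCloud (x : Fin 3 → UnitCircle) :
    ∃ b, ((persistentHomology 𝕜 1 (pointCloud x)).IsBarcode b ∧
      ∀ b', (persistentHomology 𝕜 1 (pointCloud x)).IsBarcode b' → b' = b) ∧
      b.card ≤ 1 ∧ (∀ I ∈ b, I.carrier ⊆ Set.Icc 0 1) ∧
      (barcodeRepresentation b).length = triangleBarLength (x 0) (x 1) (x 2) := by
  classical
  have hx : ∀ i, ‖(x i : Plane)‖ = 1 := fun i => norm_eq_of_mem_sphere (x i)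
  rw [pointCloud_eq]
  by_cases h : IsAcute (x 0 : Plane) (x 1) (x 2)
  · obtain ⟨φ⟩ := h.exists_intervalCoordinate (𝕜 := 𝕜) (hx 0) (hx 1) (hx 2)
    have hlt := h.longestSide_lt_two (hx 0) (hx 1) (hx 2)
    refine ⟨_, ⟨φ.isBarcode, fun b' hb' => φ.eq_singleton_of_isBarcode hb'⟩, by simp, ?_, ?_⟩
    · intro I hI
      rw [Multiset.mem_singleton] at hI
      subst hI
      have := longestSide_nonneg (x 0 : Plane) (x 1) (x 2)
      exact Set.Ico_subset_Icc_self.trans (Set.Icc_subset_Icc_left (by linarith))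
    · rw [BarcodeSpace.length_barcodeRepresentation_singleton, triangleBar,
        csSup_Ico (by linarith), csInf_Ico (by linarith), triangleBarLength, if_pos h,
        max_eq_left (by linarith)]
  · have hs := subsingleton_persistentHomology_of_not_isAcute (𝕜 := 𝕜) h
    refine ⟨0, ⟨PersistenceModule.isBarcode_zero _ hs,
      fun b' hb' => PersistenceModule.IsBarcode.eq_zero hs hb'⟩, by simp, by simp, ?_⟩
    rw [BarcodeSpace.length_barcodeRepresentation_zero, triangleBarLength, if_neg h]

theorem existsUnique_barcode_pointCloud (x : Fin 3 → UnitCircle) :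
    (∃! b, (persistentHomology 𝕜 1 (pointCloud x)).IsBarcode b) ∧
      (persistentHomology 𝕜 1 (pointCloud x)).barcode.card ≤ 1 ∧
      ∀ I ∈ (persistentHomology 𝕜 1 (pointCloud x)).barcode, I.carrier ⊆ Set.Icc 0 1 := by
  obtain ⟨b, hb, hc, hI, -⟩ := exists_barcode_pointCloud (𝕜 := 𝕜) x
  rw [PersistenceModule.barcode_eq hb.1 hb.2]
  exact ⟨⟨b, hb.1, hb.2⟩, hc, hI⟩

theorem length_barcodeMap_pointCloud (x : Fin 3 → UnitCircle) :
    (barcodeMap 𝕜 1 (pointCloud x)).length = triangleBarLength (x 0) (x 1) (x 2) := by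
  obtain ⟨b, hb, -, -, hl⟩ := exists_barcode_pointCloud (𝕜 := 𝕜) x
  rw [barcodeMap, PersistenceModule.barcode_eq hb.1 hb.2, hl]

end BarcodeOfTriangle

/-! ### The arc length measure in terms of angles -/

section ArcLength

open scoped Pointwise

/-- The point of the unit circle with the angle `θ`. -/
noncomputable def circlePoint (θ : ℝ) : UnitCircle :=
  ⟨!₂[Real.cos θ, Real.sin θ], by simp [EuclideanSpace.norm_eq]⟩

theorem continuous_circlePoint : Continuous circlePoint := by
  refine Continuous.subtype_mk ?_ _
  refine (PiLp.continuous_toLp 2 _).comp (continuous_pi fun i => ?_)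
  fin_cases i
  · exact Real.continuous_cos
  · exact Real.continuous_sin

theorem circlePoint_periodic : Function.Periodic circlePoint (2 * Real.pi) := fun θ => by
  simp [circlePoint]

theorem lintegral_ofReal_Ioo_zero_one :
    ∫⁻ r in Set.Ioi (0 : ℝ), ENNReal.ofReal r * (Set.Iio 1).indicator 1 r = 2⁻¹ := by
  have h : (fun r : ℝ => ENNReal.ofReal r * (Set.Iio 1).indicator 1 r) =
      (Set.Iio 1).indicator fun r => ENNReal.ofReal r := by
    ext r
    by_cases hr : r ∈ Set.Iio (1 : ℝ) <;> simp [hr]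
  rw [h, setLIntegral_indicator measurableSet_Iio, Set.inter_comm, Set.Ioi_inter_Iio,
    ← ofReal_integral_eq_lintegral_ofReal, ← integral_Ioc_eq_integral_Ioo,
    ← intervalIntegral.integral_of_le zero_le_one, integral_id]
  · rw [← ENNReal.ofReal_ofNat, ← ENNReal.ofReal_inv_of_pos two_pos]
    norm_num
  · exact (continuous_id.integrableOn_Icc (a := 0) (b := 1)).mono_set Set.Ioo_subset_Icc_self
  · exact (ae_restrict_iff' measurableSet_Ioo).2 (.of_forall fun r hr => hr.1.le)

theorem smul_circlePoint_mem_iff {s : Set UnitCircle} {r θ : ℝ} (hr : 0 < r) :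
    r • (circlePoint θ : Plane) ∈ Set.Ioo (0 : ℝ) 1 • ((↑) '' s : Set Plane) ↔
      r < 1 ∧ circlePoint θ ∈ s := by
  constructor
  · rintro ⟨ρ, hρ, -, ⟨y, hy, rfl⟩, h⟩
    have h1 : ρ = r := by
      have := congrArg norm h
      simpa [norm_smul, abs_of_pos hr, abs_of_pos hρ.1] using this
    subst h1
    have h2 : y = circlePoint θ := Subtype.ext (smul_right_injective _ hr.ne' h)
    exact ⟨hρ.2, h2 ▸ hy⟩
  · rintro ⟨h1, h2⟩
    exact Set.smul_mem_smul ⟨hr, h1⟩ ⟨_, h2, rfl⟩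

/-- The open cone over `s` is the preimage of `s` under radial projection, restricted to the
punctured open unit disk. -/
theorem measurableSet_Ioo_smul {s : Set UnitCircle} (hs : MeasurableSet s) :
    MeasurableSet (Set.Ioo (0 : ℝ) 1 • ((↑) '' s : Set Plane)) := by
  have h : Set.Ioo (0 : ℝ) 1 • ((↑) '' s : Set Plane) =
      {x : Plane | x ≠ 0 ∧ ‖x‖ < 1} ∩ (fun x : Plane => ‖x‖⁻¹ • x) ⁻¹' ((↑) '' s) := by
    ext x
    constructor
    · rintro ⟨ρ, hρ, -, ⟨y, hy, rfl⟩, rfl⟩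
      have hn : ‖ρ • (y : Plane)‖ = ρ := by
        rw [norm_smul, norm_eq_of_mem_sphere y, mul_one, Real.norm_of_nonneg hρ.1.le]
      refine ⟨⟨fun h0 => ?_, hn.trans_lt hρ.2⟩, y, hy, ?_⟩
      · simp only at h0
        rw [h0, norm_zero] at hn
        exact hρ.1.ne hn
      · simp only
        rw [hn, smul_smul, inv_mul_cancel₀ hρ.1.ne', one_smul]
    · rintro ⟨⟨h0, h1⟩, y, hy, hxy⟩
      have hp := norm_pos_iff.2 h0
      refine ⟨‖x‖, ⟨hp, h1⟩, y, ⟨y, hy, rfl⟩, ?_⟩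
      simp only at hxy ⊢
      rw [hxy, smul_smul, mul_inv_cancel₀ hp.ne', one_smul]
  rw [h]
  refine MeasurableSet.inter ?_ ?_
  · exact (measurableSet_singleton (0 : Plane)).compl.inter
      (measurableSet_lt measurable_norm measurable_const)
  · exact (measurable_norm.inv.smul measurable_id)
      ((MeasurableEmbedding.subtype_coe Metric.isClosed_sphere.measurableSet).measurableSet_image.2
        hs)

/-- `toSphere` assigns to `s` the dimension `2` times the area of the cone over `s`. In polar
coordinates this area splits into the radial factor `1/2` and the length of the set of angles. The
range `(-π, π)` is that of `polarCoord`. -/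
theorem arcLength_eq_map :
    arcLength = (volume.restrict (Set.Ioo (-Real.pi) Real.pi)).map circlePoint := by
  ext s hs
  have hm := continuous_circlePoint.measurable hs
  rw [arcLength, Measure.toSphere_apply' _ hs, Measure.map_apply continuous_circlePoint.measurable hs,
    finrank_euclideanSpace_fin]
  set T : Set Plane := Set.Ioo (0 : ℝ) 1 • ((↑) '' s : Set Plane) with hT
  have hTm : MeasurableSet T := measurableSet_Ioo_smul hs
  have hg := (EuclideanSpace.volume_preserving_symm_measurableEquiv_toLp (Fin 2)).trans
    (volume_preserving_finTwoArrow ℝ)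
  have h1 : volume T = ∫⁻ p : ℝ × ℝ, T.indicator 1 (!₂[p.1, p.2] : Plane) := by
    rw [← lintegral_indicator_one hTm, ← hg.symm.lintegral_comp (measurable_one.indicator hTm)]
    rfl
  have h2 : ∀ p ∈ polarCoord.target, ENNReal.ofReal p.1 •
      T.indicator 1 (!₂[(polarCoord.symm p).1, (polarCoord.symm p).2] : Plane) =
      (ENNReal.ofReal p.1 * (Set.Iio 1).indicator 1 p.1) *
        (circlePoint ⁻¹' s).indicator 1 p.2 := by
    intro p hp
    have hp1 : 0 < p.1 := hp.1
    have h3 : (!₂[(polarCoord.symm p).1, (polarCoord.symm p).2] : Plane) =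
        p.1 • (circlePoint p.2 : Plane) := by
      ext i
      fin_cases i <;> simp [circlePoint]
    have h4 := smul_circlePoint_mem_iff (s := s) (θ := p.2) hp1
    rw [h3, smul_eq_mul, mul_assoc]
    congr 1
    rw [← hT] at h4
    by_cases h5 : p.1 < 1 <;> by_cases h6 : circlePoint p.2 ∈ s <;> simp [h4, h5, h6]
  rw [h1, ← lintegral_comp_polarCoord_symm
    (fun p : ℝ × ℝ => T.indicator 1 (!₂[p.1, p.2] : Plane)),
    setLIntegral_congr_fun polarCoord.open_target.measurableSet h2, polarCoord_target,
    Measure.volume_eq_prod, ← Measure.prod_restrict,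
    lintegral_prod_mul (f := fun r => ENNReal.ofReal r * (Set.Iio 1).indicator 1 r)
      (g := (circlePoint ⁻¹' s).indicator 1),
    lintegral_ofReal_Ioo_zero_one, lintegral_indicator_one hm, ← mul_assoc]
  · rw [Nat.cast_ofNat, ENNReal.mul_inv_cancel two_ne_zero ENNReal.ofNat_ne_top, one_mul]
  · exact (ENNReal.measurable_ofReal.mul
      (measurable_one.indicator measurableSet_Iio)).aemeasurable
  · exact (measurable_one.indicator hm).aemeasurable

/-- The uniform distribution on the angles. -/
noncomputable def uniformAngle : Measure ℝ :=
  (ENNReal.ofReal (2 * Real.pi))⁻¹ • volume.restrict (Set.Ioo (-Real.pi) Real.pi)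

instance isProbabilityMeasure_uniformAngle : IsProbabilityMeasure uniformAngle := ⟨by
  rw [uniformAngle, Measure.smul_apply, Measure.restrict_apply_univ, Real.volume_Ioo,
    show Real.pi - -Real.pi = 2 * Real.pi by ring, smul_eq_mul]
  exact ENNReal.inv_mul_cancel (by simpa using Real.pi_pos) ENNReal.ofReal_ne_top⟩

theorem map_eq_of_isUniform {Ω : Type*} [MeasurableSpace Ω] {μ : Measure Ω} {X : Ω → UnitCircle}
    (h : pdf.IsUniform X Set.univ μ arcLength) : μ.map X = uniformAngle.map circlePoint := by
  have h1 : arcLength Set.univ = ENNReal.ofReal (2 * Real.pi) := by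
    rw [arcLength_eq_map, Measure.map_apply continuous_circlePoint.measurable .univ,
      Set.preimage_univ, Measure.restrict_apply_univ, Real.volume_Ioo]
    congr 1
    ring
  rw [pdf.IsUniform, ProbabilityTheory.cond, Measure.restrict_univ, h1, arcLength_eq_map] at h
  rw [h, uniformAngle, Measure.map_smul]

theorem integral_uniformAngle (f : ℝ → ℝ) :
    ∫ θ, f θ ∂uniformAngle = (2 * Real.pi)⁻¹ * ∫ θ in -Real.pi..Real.pi, f θ := by
  rw [uniformAngle, integral_smul_measure, intervalIntegral.integral_of_le
    (by linarith [Real.pi_pos]), integral_Ioc_eq_integral_Ioo, ENNReal.toReal_inv,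
    ENNReal.toReal_ofReal (by positivity), smul_eq_mul]

/-- Rotation invariance, which later eliminates the first angle. -/
theorem integral_uniformAngle_sub {f : ℝ → ℝ} (hf : Function.Periodic f (2 * Real.pi)) (a : ℝ) :
    ∫ θ, f (θ - a) ∂uniformAngle = ∫ θ, f θ ∂uniformAngle := by
  rw [integral_uniformAngle, integral_uniformAngle, intervalIntegral.integral_comp_sub_right]
  have := hf.intervalIntegral_add_eq (-Real.pi - a) (-Real.pi)
  rw [show -Real.pi - a + 2 * Real.pi = Real.pi - a by ring,
    show -Real.pi + 2 * Real.pi = Real.pi by ring] at this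
  rw [this]

end ArcLength

/-! ### The bar length in terms of angles -/

section Angles

open Real
open scoped RealInnerProductSpace

/-- The chord from `a` to `b` is `2 sin ((b - a) / 2)` times the unit vector at angle `(a + b) / 2 +
π / 2`; two such directions differ by `(b - c) / 2`. -/
theorem inner_circlePoint (a b c : ℝ) :
    ⟪(circlePoint b : Plane) - circlePoint a, (circlePoint c : Plane) - circlePoint a⟫ =
      4 * (sin ((b - a) / 2) * sin ((c - a) / 2) * cos ((b - c) / 2)) := by
  rw [inner_sub_sub_eq]
  simp only [circlePoint, Matrix.cons_val_zero, Matrix.cons_val_one]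
  rw [cos_sub_cos, cos_sub_cos, sin_sub_sin, sin_sub_sin,
    show (b - c) / 2 = (b + a) / 2 - (c + a) / 2 by ring, cos_sub]
  ring

theorem dist_circlePoint (a b : ℝ) :
    dist (circlePoint a : Plane) (circlePoint b) = 2 * |sin ((a - b) / 2)| := by
  rw [EuclideanSpace.dist_eq, Fin.sum_univ_two]
  simp only [circlePoint, Matrix.cons_val_zero, Matrix.cons_val_one, Real.dist_eq, sq_abs]
  rw [cos_sub_cos, sin_sub_sin, show ∀ x y : ℝ, (-2 * x * y) ^ 2 = (2 * y) ^ 2 * x ^ 2 by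
    intros; ring, show ∀ x y : ℝ, (2 * y * x) ^ 2 = (2 * y) ^ 2 * x ^ 2 by intros; ring,
    ← mul_add, sin_sq_add_cos_sq, mul_one, sqrt_sq_eq_abs, abs_mul, abs_two]

theorem isAcute_circlePoint_iff (a b c : ℝ) :
    IsAcute (circlePoint a) (circlePoint b) (circlePoint c) ↔
      0 < sin ((b - a) / 2) * sin ((c - a) / 2) * cos ((b - c) / 2) ∧
      0 < sin ((c - b) / 2) * sin ((a - b) / 2) * cos ((c - a) / 2) ∧
      0 < sin ((a - c) / 2) * sin ((b - c) / 2) * cos ((a - b) / 2) := by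
  rw [IsAcute, inner_circlePoint, inner_circlePoint, inner_circlePoint]
  simp only [Nat.ofNat_pos, mul_pos_iff_of_pos_left]

theorem longestSide_circlePoint (a b c : ℝ) :
    longestSide (circlePoint a) (circlePoint b) (circlePoint c) =
      2 * max |sin ((a - b) / 2)| (max |sin ((b - c) / 2)| |sin ((c - a) / 2)|) := by
  rw [longestSide, dist_circlePoint, dist_circlePoint, dist_circlePoint,
    mul_max_of_nonneg _ _ zero_le_two, mul_max_of_nonneg _ _ zero_le_two]

/-- The bar length of the triangle with vertices at the angles `0`, `u` and `v`. -/
noncomputable def angleBarLength (u v : ℝ) : ℝ :=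
  triangleBarLength (circlePoint 0) (circlePoint u) (circlePoint v)

theorem triangleBarLength_circlePoint (a b c : ℝ) :
    triangleBarLength (circlePoint a) (circlePoint b) (circlePoint c) =
      angleBarLength (b - a) (c - a) := by
  simp only [angleBarLength, triangleBarLength, isAcute_circlePoint_iff, longestSide_circlePoint]
  simp only [sub_zero, zero_sub, neg_sub, sub_sub_sub_cancel_right]

theorem angleBarLength_neg (u v : ℝ) : angleBarLength (-u) (-v) = angleBarLength u v := by
  simp only [angleBarLength, triangleBarLength, isAcute_circlePoint_iff, longestSide_circlePoint]
  have h1 : (-u - -v) / 2 = -((u - v) / 2) := by ring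
  have h2 : (-v - -u) / 2 = -((v - u) / 2) := by ring
  simp only [sub_zero, zero_sub, neg_neg, h1, h2, sin_neg, cos_neg, abs_neg, neg_div,
    neg_mul, mul_neg]

theorem angleBarLength_periodic_left (v : ℝ) :
    Function.Periodic (fun u => angleBarLength u v) (2 * π) := fun u => by
  simp only [angleBarLength, circlePoint_periodic u]

theorem angleBarLength_periodic_right (u : ℝ) :
    Function.Periodic (angleBarLength u) (2 * π) := fun v => by
  simp only [angleBarLength, circlePoint_periodic v]

/-- Each angle is half the opposite arc, so acuteness means that the arcs `u`, `v - u` and `2π - v`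
are all positive and shorter than `π`. In the proof the factors of known sign are divided out. -/
theorem isAcute_angles_iff {u v : ℝ} (hu : u ∈ Set.Ioo 0 π) (hv : v ∈ Set.Ioo 0 (2 * π)) :
    IsAcute (circlePoint 0) (circlePoint u) (circlePoint v) ↔ π < v ∧ v < π + u := by
  obtain ⟨hu0, hu1⟩ := hu
  obtain ⟨hv0, hv1⟩ := hv
  have su : 0 < sin (u / 2) := sin_pos_of_pos_of_lt_pi (by linarith) (by linarith)
  have sv : 0 < sin (v / 2) := sin_pos_of_pos_of_lt_pi (by linarith) (by linarith)
  have cu : 0 < cos (u / 2) := cos_pos_of_mem_Ioo ⟨by linarith, by linarith⟩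
  have h1 : (v - u) / 2 = -((u - v) / 2) := by ring
  rw [isAcute_circlePoint_iff]
  simp only [sub_zero, zero_sub, neg_div, sin_neg, cos_neg]
  rw [show sin (u / 2) * sin (v / 2) * cos ((u - v) / 2) =
      (sin (u / 2) * sin (v / 2)) * cos ((v - u) / 2) by rw [h1, cos_neg],
    show sin ((v - u) / 2) * -sin (u / 2) * cos (v / 2) =
      sin (u / 2) * (sin ((v - u) / 2) * -cos (v / 2)) by ring,
    show -sin (v / 2) * sin ((u - v) / 2) * cos (u / 2) =
      (sin (v / 2) * cos (u / 2)) * sin ((v - u) / 2) by rw [h1, sin_neg]; ring,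
    mul_pos_iff_of_pos_left (mul_pos su sv), mul_pos_iff_of_pos_left su,
    mul_pos_iff_of_pos_left (mul_pos sv cu)]
  constructor
  · rintro ⟨h2, h3, h4⟩
    have h5 : cos (v / 2) < 0 := by
      have := (mul_pos_iff_of_pos_left h4).1 h3
      linarith
    refine ⟨?_, ?_⟩
    · by_contra! h
      exact absurd (cos_nonneg_of_mem_Icc ⟨by linarith, by linarith⟩) (not_le.2 h5)
    · by_contra! h
      exact absurd (cos_nonpos_of_pi_div_two_le_of_le (x := (v - u) / 2) (by linarith)
        (by linarith)) (not_le.2 h2)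
  · rintro ⟨h2, h3⟩
    have h4 : 0 < sin ((v - u) / 2) := sin_pos_of_pos_of_lt_pi (by linarith) (by linarith)
    refine ⟨cos_pos_of_mem_Ioo ⟨by linarith, by linarith⟩, mul_pos h4 (neg_pos.2 ?_), h4⟩
    exact cos_neg_of_pi_div_two_lt_of_lt (by linarith) (by linarith)

theorem angleBarLength_eq_zero {u v : ℝ} (hu : u ∈ Set.Ioo 0 π) (hv : v ∈ Set.Ioo 0 (2 * π))
    (h : v ≤ π ∨ π + u ≤ v) : angleBarLength u v = 0 := by
  rw [angleBarLength, triangleBarLength, if_neg]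
  rw [isAcute_angles_iff hu hv, not_and_or, not_lt, not_lt]
  exact h

theorem angleBarLength_eq {u v : ℝ} (hu : u ∈ Set.Ioo 0 π) (hv : v ∈ Set.Ioo π (π + u)) :
    angleBarLength u v = 1 - max (sin (u / 2)) (max (sin ((v - u) / 2)) (sin (v / 2))) := by
  have hu' := hu
  obtain ⟨hu0, hu1⟩ := hu
  obtain ⟨hv0, hv1⟩ := hv
  have su : 0 < sin (u / 2) := sin_pos_of_pos_of_lt_pi (by linarith) (by linarith)
  have sv : 0 < sin (v / 2) := sin_pos_of_pos_of_lt_pi (by linarith) (by linarith)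
  have suv : 0 < sin ((v - u) / 2) := sin_pos_of_pos_of_lt_pi (by linarith) (by linarith)
  rw [angleBarLength, triangleBarLength,
    if_pos ((isAcute_angles_iff hu' ⟨by linarith, by linarith⟩).2 ⟨hv0, hv1⟩),
    longestSide_circlePoint, zero_sub, sub_zero, neg_div, sin_neg, abs_neg, abs_of_pos su,
    abs_of_pos sv, show (u - v) / 2 = -((v - u) / 2) by ring, sin_neg, abs_neg, abs_of_pos suv]
  ring

/-- The integral over the third angle in the range where the third side is the shorter one. -/
noncomputable def halfIntegral (u : ℝ) : ℝ :=
  ∫ c in (π - u / 2)..π, (1 - max (sin (u / 2)) (sin (c / 2)))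

/-- For `v ≥ π + u / 2` the arc `2π - v` is at most `v - u`, so `sin (v / 2)` drops out of the
maximum; then `c = v - u`. -/
theorem integral_half_right {u : ℝ} (hu : u ∈ Set.Ioo 0 π) :
    ∫ v in (π + u / 2)..(π + u), angleBarLength u v = halfIntegral u := by
  obtain ⟨hu0, hu1⟩ := id hu
  have h : Set.EqOn (angleBarLength u) (fun v => 1 - max (sin (u / 2)) (sin ((v - u) / 2)))
      (Set.uIoo (π + u / 2) (π + u)) := by
    intro v hv
    rw [Set.uIoo_of_le (by linarith)] at hv
    obtain ⟨hv0, hv1⟩ := hv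
    simp only
    rw [angleBarLength_eq hu ⟨by linarith, hv1⟩]
    congr 2
    refine max_eq_left ?_
    rw [← sin_pi_sub]
    exact sin_le_sin_of_le_of_le_pi_div_two (by linarith) (by linarith) (by linarith)
  rw [intervalIntegral.integral_congr_uIoo h, intervalIntegral.integral_comp_sub_right
    (fun c => 1 - max (sin (u / 2)) (sin (c / 2))), halfIntegral]
  congr 1 <;> ring

/-- The reflection `v ↦ 2π + u - v` exchanges the arcs `v - u` and `2π - v` and maps this half onto
the other. -/
theorem integral_half_left {u : ℝ} (hu : u ∈ Set.Ioo 0 π) :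
    ∫ v in π..(π + u / 2), angleBarLength u v = halfIntegral u := by
  obtain ⟨hu0, hu1⟩ := id hu
  rw [← integral_half_right hu]
  have h := intervalIntegral.integral_comp_sub_left (a := π) (b := π + u / 2) (angleBarLength u)
    (2 * π + u)
  rw [show 2 * π + u - (π + u / 2) = π + u / 2 by ring, show 2 * π + u - π = π + u by ring] at h
  rw [← h]
  refine intervalIntegral.integral_congr_uIoo fun v hv => ?_
  rw [Set.uIoo_of_le (by linarith)] at hv
  obtain ⟨hv0, hv1⟩ := hv
  rw [angleBarLength_eq hu ⟨by linarith, by linarith⟩,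
    angleBarLength_eq hu ⟨by linarith, by linarith⟩,
    show (2 * π + u - v - u) / 2 = π - v / 2 by ring,
    show (2 * π + u - v) / 2 = π - (v - u) / 2 by ring, sin_pi_sub, sin_pi_sub, max_comm (sin (v / 2))]

theorem intervalIntegrable_angleBarLength {u : ℝ} (hu : u ∈ Set.Ioo 0 π) {a b : ℝ}
    (ha : π ≤ a) (hab : a ≤ b) (hb : b ≤ π + u) :
    IntervalIntegrable (angleBarLength u) volume a b := by
  refine (intervalIntegrable_congr_uIoo (g := fun v =>
    1 - max (sin (u / 2)) (max (sin ((v - u) / 2)) (sin (v / 2)))) fun v hv => ?_).2 ?_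
  · rw [Set.uIoo_of_le hab] at hv
    exact angleBarLength_eq hu ⟨ha.trans_lt hv.1, hv.2.trans_le hb⟩
  · exact Continuous.intervalIntegrable (by fun_prop) _ _

/-- Periodicity moves the range to `[0, 2π]`, where only `(π, π + u)` contributes; its two halves
have equal integrals. -/
theorem integral_angleBarLength {u : ℝ} (hu : u ∈ Set.Ioo 0 π) :
    ∫ v in -π..π, angleBarLength u v = 2 * halfIntegral u := by
  obtain ⟨hu0, hu1⟩ := id hu
  have hper := (angleBarLength_periodic_right u).intervalIntegral_add_eq (-π) 0
  rw [show -π + 2 * π = π by ring, zero_add] at hper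
  have hz1 : Set.EqOn (angleBarLength u) (fun _ => 0) (Set.uIoo 0 π) := fun v hv => by
    rw [Set.uIoo_of_le pi_pos.le] at hv
    exact angleBarLength_eq_zero hu ⟨hv.1, by linarith [hv.2]⟩ (Or.inl hv.2.le)
  have hz2 : Set.EqOn (angleBarLength u) (fun _ => 0) (Set.uIoo (π + u) (2 * π)) := fun v hv => by
    rw [Set.uIoo_of_le (by linarith)] at hv
    exact angleBarLength_eq_zero hu ⟨by linarith [hv.1], hv.2⟩ (Or.inr hv.1.le)
  have hi0 : IntervalIntegrable (angleBarLength u) volume 0 π :=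
    (intervalIntegrable_congr_uIoo hz1).2 (by simp)
  have hi1 := intervalIntegrable_angleBarLength hu le_rfl (b := π + u / 2) (by linarith)
    (by linarith)
  have hi2 := intervalIntegrable_angleBarLength hu (a := π + u / 2) (by linarith) (by linarith)
    (le_refl (π + u))
  have hi3 : IntervalIntegrable (angleBarLength u) volume (π + u) (2 * π) :=
    (intervalIntegrable_congr_uIoo hz2).2 (by simp)
  rw [hper, ← intervalIntegral.integral_add_adjacent_intervals hi0 ((hi1.trans hi2).trans hi3),
    ← intervalIntegral.integral_add_adjacent_intervals (hi1.trans hi2) hi3,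
    ← intervalIntegral.integral_add_adjacent_intervals hi1 hi2, integral_half_left hu,
    integral_half_right hu, intervalIntegral.integral_congr_uIoo hz1,
    intervalIntegral.integral_congr_uIoo hz2]
  simp
  ring

theorem integral_one_sub_sin_half (a b : ℝ) :
    ∫ c in a..b, (1 - sin (c / 2)) = b - a + 2 * (cos (b / 2) - cos (a / 2)) := by
  rw [intervalIntegral.integral_eq_sub_of_hasDerivAt (f := fun c => c + 2 * cos (c / 2))]
  · ring
  · intro c _
    have := (hasDerivAt_id c).add ((((hasDerivAt_id c).div_const 2).cos).const_mul 2)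
    refine this.congr_deriv ?_
    simp only [id]
    ring
  · exact Continuous.intervalIntegrable (by fun_prop) _ _

/-- Here `u ≤ π - u / 2 ≤ c`, so `sin (c / 2)` is the maximum throughout. -/
theorem halfIntegral_of_le {u : ℝ} (hu0 : 0 ≤ u) (hu : u ≤ 2 * π / 3) :
    halfIntegral u = u / 2 - 2 * sin (u / 4) := by
  have hpi := pi_pos
  rw [halfIntegral, intervalIntegral.integral_congr (g := fun c => 1 - sin (c / 2)),
    integral_one_sub_sin_half, cos_pi_div_two, show (π - u / 2) / 2 = π / 2 - u / 4 by ring,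
    cos_pi_div_two_sub]
  · ring
  · intro c hc
    rw [Set.uIcc_of_le (by linarith)] at hc
    obtain ⟨hc0, hc1⟩ := hc
    simp only
    rw [max_eq_right]
    exact sin_le_sin_of_le_of_le_pi_div_two (by linarith) (by linarith) (by linarith)

/-- Now `u` lies between `π - u / 2` and `π`, and the maximum switches from `sin (u / 2)` to `sin (c
/ 2)` at `c = u`. -/
theorem halfIntegral_of_ge {u : ℝ} (hu : 2 * π / 3 ≤ u) (hu1 : u ≤ π) :
    halfIntegral u =
      (3 * u / 2 - π) * (1 - sin (u / 2)) + (π - u - 2 * cos (u / 2)) := by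
  have hpi := pi_pos
  have hc : Continuous fun c => 1 - max (sin (u / 2)) (sin (c / 2)) := by fun_prop
  rw [halfIntegral, ← intervalIntegral.integral_add_adjacent_intervals (b := u)
    (hc.intervalIntegrable _ _) (hc.intervalIntegrable _ _),
    intervalIntegral.integral_congr (b := u) (g := fun _ => 1 - sin (u / 2)),
    intervalIntegral.integral_congr (b := π) (g := fun c => 1 - sin (c / 2)),
    integral_one_sub_sin_half, intervalIntegral.integral_const, cos_pi_div_two, smul_eq_mul]
  · ring
  · intro c hc
    rw [Set.uIcc_of_le (by linarith)] at hc
    obtain ⟨hc0, hc1⟩ := hc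
    simp only
    rw [max_eq_right]
    exact sin_le_sin_of_le_of_le_pi_div_two (by linarith) (by linarith) (by linarith)
  · intro c hc
    rw [Set.uIcc_of_le (by linarith)] at hc
    obtain ⟨hc0, hc1⟩ := hc
    simp only
    rw [max_eq_left]
    exact sin_le_sin_of_le_of_le_pi_div_two (by linarith) (by linarith) (by linarith)

theorem integral_first_range :
    ∫ u in 0..(2 * π / 3), (u / 2 - 2 * sin (u / 4)) = π ^ 2 / 9 + 4 * √3 - 8 := by
  rw [intervalIntegral.integral_eq_sub_of_hasDerivAt
    (f := fun u => u ^ 2 / 4 + 8 * cos (u / 4))]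
  · rw [show 2 * π / 3 / 4 = π / 6 by ring, cos_pi_div_six, zero_div, cos_zero]
    ring
  · intro u _
    have := (((hasDerivAt_id u).pow 2).div_const 4).add
      ((((hasDerivAt_id u).div_const 4).cos).const_mul 8)
    refine this.congr_deriv ?_
    simp only [id, Nat.cast_ofNat]
    ring
  · exact Continuous.intervalIntegrable (by fun_prop) _ _

theorem integral_second_range :
    ∫ u in (2 * π / 3)..π, ((3 * u / 2 - π) * (1 - sin (u / 2)) + (π - u - 2 * cos (u / 2))) =
      5 * π ^ 2 / 36 - 10 + 5 * √3 := by
  rw [intervalIntegral.integral_eq_sub_of_hasDerivAt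
    (f := fun u => u ^ 2 / 4 + (3 * u - 2 * π) * cos (u / 2) - 10 * sin (u / 2))]
  · rw [show 2 * π / 3 / 2 = π / 3 by ring, cos_pi_div_three, sin_pi_div_three, cos_pi_div_two,
      sin_pi_div_two]
    ring
  · intro u _
    have hc := ((hasDerivAt_id u).div_const 2).cos
    have hs := ((hasDerivAt_id u).div_const 2).sin
    have := ((((hasDerivAt_id u).pow 2).div_const 4).add
      ((((hasDerivAt_id u).const_mul 3).sub_const (2 * π)).mul hc)).sub (hs.const_mul 10)
    refine this.congr_deriv ?_
    simp only [id, Nat.cast_ofNat]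
    ring
  · exact Continuous.intervalIntegrable (by fun_prop) _ _

/-- The total integral of the bar length over the second and third angle. -/
theorem integral_integral_angleBarLength :
    ∫ u in -π..π, ∫ v in -π..π, angleBarLength u v = π ^ 2 - 72 + 36 * √3 := by
  have hpi := pi_pos
  set G : ℝ → ℝ := fun u => ∫ v in -π..π, angleBarLength u v with hG
  have heven : ∀ u, G (-u) = G u := fun u => by
    have h := intervalIntegral.integral_comp_neg (a := -π) (b := π) (angleBarLength (-u))
    rw [neg_neg] at h
    simp only [hG]
    rw [← h]
    simp only [angleBarLength_neg]
  -- Open intervals suffice for the integrals and avoid the degenerate values `u = 0` and `u = π`.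
  have h1 : Set.EqOn G (fun u => 2 * (u / 2 - 2 * sin (u / 4))) (Set.uIoo 0 (2 * π / 3)) :=
    fun u hu => by
      rw [Set.uIoo_of_le (by linarith)] at hu
      simp only [hG]
      rw [integral_angleBarLength ⟨hu.1, by linarith [hu.2]⟩,
        halfIntegral_of_le hu.1.le hu.2.le]
  have h2 : Set.EqOn G (fun u => 2 * ((3 * u / 2 - π) * (1 - sin (u / 2)) +
      (π - u - 2 * cos (u / 2)))) (Set.uIoo (2 * π / 3) π) :=
    fun u hu => by
      rw [Set.uIoo_of_le (by linarith)] at hu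
      simp only [hG]
      rw [integral_angleBarLength ⟨by linarith [hu.1], hu.2⟩,
        halfIntegral_of_ge hu.1.le hu.2.le]
  have hi1 : IntervalIntegrable G volume 0 (2 * π / 3) :=
    (intervalIntegrable_congr_uIoo h1).2 (Continuous.intervalIntegrable (by fun_prop) _ _)
  have hi2 : IntervalIntegrable G volume (2 * π / 3) π :=
    (intervalIntegrable_congr_uIoo h2).2 (Continuous.intervalIntegrable (by fun_prop) _ _)
  have hi := hi1.trans hi2
  have hineg : IntervalIntegrable G volume (-π) 0 := by
    have := (intervalIntegrable_congr (g := G) fun u _ => heven u).1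
      (by simpa [div_neg] using hi.comp_mul_left (c := -1) : IntervalIntegrable (fun u => G (-u)) volume 0 (-π))
    exact this.symm
  have hneg : ∫ u in -π..0, G u = ∫ u in 0..π, G u := by
    have := intervalIntegral.integral_comp_neg (a := -π) (b := 0) G
    simpa only [heven, neg_neg, neg_zero] using this
  rw [← intervalIntegral.integral_add_adjacent_intervals hineg hi, hneg,
    ← intervalIntegral.integral_add_adjacent_intervals hi1 hi2,
    intervalIntegral.integral_congr_uIoo h1, intervalIntegral.integral_congr_uIoo h2,
    intervalIntegral.integral_const_mul, intervalIntegral.integral_const_mul, integral_first_range,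
    integral_second_range]
  ring

end Angles

/-! ### Integrability and the expected bar length -/

section Expectation

open Real

theorem measurable_triangleBarLength {α : Type*} [MeasurableSpace α] {p q r : α → Plane}
    (hp : Measurable p) (hq : Measurable q) (hr : Measurable r) :
    Measurable fun x => triangleBarLength (p x) (q x) (r x) := by
  classical
  have hin : ∀ {f g h : α → Plane}, Measurable f → Measurable g → Measurable h →
      MeasurableSet {x | 0 < inner ℝ (g x - f x) (h x - f x)} := fun hf hg hh =>
    measurableSet_lt measurable_const ((hg.sub hf).inner (hh.sub hf))
  unfold triangleBarLength longestSide
  refine Measurable.ite ?_ ?_ measurable_const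
  · exact (hin hp hq hr).inter ((hin hq hr hp).inter (hin hr hp hq))
  · exact measurable_const.sub
      (((hp.dist hq).max ((hq.dist hr).max (hr.dist hp))).div_const 2)

theorem norm_triangleBarLength_le (p q r : UnitCircle) :
    ‖triangleBarLength p q r‖ ≤ 1 := by
  rw [triangleBarLength]
  split_ifs with h
  · have h1 := h.longestSide_lt_two (norm_eq_of_mem_sphere p) (norm_eq_of_mem_sphere q)
      (norm_eq_of_mem_sphere r)
    have h2 := longestSide_nonneg (p : Plane) q r
    rw [norm_eq_abs, abs_le]
    constructor <;> linarith
  · simp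

theorem integrable_triangleBarLength {α : Type*} [MeasurableSpace α] {μ : Measure α}
    [IsFiniteMeasure μ] {p q r : α → UnitCircle} (hp : Measurable p) (hq : Measurable q)
    (hr : Measurable r) : Integrable (fun x => triangleBarLength (p x) (q x) (r x)) μ :=
  Integrable.of_bound (measurable_triangleBarLength hp.subtype_val hq.subtype_val
    hr.subtype_val).aestronglyMeasurable 1 (.of_forall fun _ => norm_triangleBarLength_le _ _ _)

/-- The expected bar length for three independent uniform angles. -/
theorem integral_triangleBarLength_angles :
    ∫ θ : Fin 3 → ℝ, triangleBarLength (circlePoint (θ 0)) (circlePoint (θ 1)) (circlePoint (θ 2))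
      ∂(Measure.pi fun _ => uniformAngle) = 9 * (√3 - 2) / π ^ 2 + 1 / 4 := by
  have hc := continuous_circlePoint.measurable
  have h1 := (measurePreserving_piFinSuccAbove (fun _ : Fin 3 => uniformAngle) 0).symm.integral_comp'
    (fun θ : Fin 3 → ℝ =>
      triangleBarLength (circlePoint (θ 0)) (circlePoint (θ 1)) (circlePoint (θ 2)))
  -- The conditional expectation given the first angle `a` does not depend on `a`: by periodicity
  -- the shift is removed first from `v`, then from `u`.
  have h2 : ∀ a : ℝ, ∫ θ : Fin 2 → ℝ,
      triangleBarLength (circlePoint a) (circlePoint (θ 0)) (circlePoint (θ 1))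
        ∂(Measure.pi fun _ => uniformAngle) =
      ∫ u, ∫ v, angleBarLength u v ∂uniformAngle ∂uniformAngle := by
    intro a
    have h3 := (measurePreserving_finTwoArrow uniformAngle).integral_comp'
      (fun p : ℝ × ℝ => triangleBarLength (circlePoint a) (circlePoint p.1) (circlePoint p.2))
    refine h3.trans ((integral_prod _ (integrable_triangleBarLength measurable_const
      (hc.comp measurable_fst) (hc.comp measurable_snd))).trans ?_)
    simp only [Function.comp_apply, triangleBarLength_circlePoint]
    have h4 : ∀ u, ∫ v, angleBarLength (u - a) (v - a) ∂uniformAngle =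
        ∫ v, angleBarLength (u - a) v ∂uniformAngle := fun u =>
      integral_uniformAngle_sub (angleBarLength_periodic_right _) a
    simp only [h4]
    refine integral_uniformAngle_sub (f := fun u => ∫ v, angleBarLength u v ∂uniformAngle)
      (fun u => ?_) a
    exact integral_congr_ae (.of_forall fun v => angleBarLength_periodic_left v u)
  have h5 : Integrable (fun p : ℝ × (Fin 2 → ℝ) =>
      triangleBarLength (circlePoint p.1) (circlePoint (p.2 0)) (circlePoint (p.2 1)))
      (uniformAngle.prod (Measure.pi fun _ => uniformAngle)) :=
    integrable_triangleBarLength (hc.comp measurable_fst)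
      (hc.comp ((measurable_pi_apply 0).comp measurable_snd))
      (hc.comp ((measurable_pi_apply 1).comp measurable_snd))
  rw [← h1]
  refine (integral_prod _ h5).trans ?_
  simp only [h2]
  rw [integral_const, probReal_univ, one_smul, integral_uniformAngle]
  simp only [integral_uniformAngle]
  rw [intervalIntegral.integral_const_mul, integral_integral_angleBarLength]
  field_simp
  ring

end Expectation

theorem mainTheorem9 {𝕜 : Type*} [Field 𝕜] {Ω : Type*} [MeasurableSpace Ω]
    (μ : Measure Ω) [IsProbabilityMeasure μ] (X : Fin 3 → Ω → UnitCircle)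
    (hmeas : ∀ i, Measurable (X i))
    (hunif : ∀ i, pdf.IsUniform (X i) Set.univ μ arcLength)
    (hindep : ProbabilityTheory.iIndepFun X μ) :
    (∀ ω, (∃! b, (persistentHomology 𝕜 1 (pointCloud fun i => X i ω)).IsBarcode b) ∧
      (persistentHomology 𝕜 1 (pointCloud fun i => X i ω)).barcode.card ≤ 1 ∧
      ∀ I ∈ (persistentHomology 𝕜 1 (pointCloud fun i => X i ω)).barcode,
        I.carrier ⊆ Set.Icc 0 1) ∧
    Integrable (fun ω => (barcodeMap 𝕜 1 (pointCloud fun i => X i ω)).length) μ ∧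
    ∫ ω, (barcodeMap 𝕜 1 (pointCloud fun i => X i ω)).length ∂μ =
      9 * (√3 - 2) / Real.pi ^ 2 + 1 / 4 := by
  simp only [length_barcodeMap_pointCloud]
  refine ⟨fun ω => existsUnique_barcode_pointCloud _,
    integrable_triangleBarLength (hmeas 0) (hmeas 1) (hmeas 2), ?_⟩
  have hc := continuous_circlePoint.measurable
  have : IsProbabilityMeasure (uniformAngle.map circlePoint) :=
    Measure.isProbabilityMeasure_map hc.aemeasurable
  have hcpi : Measurable fun (θ : Fin 3 → ℝ) i => circlePoint (θ i) :=
    measurable_pi_lambda _ fun i => hc.comp (measurable_pi_apply i)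
  -- Independence makes the joint law a product, so it is the image of three independent uniform
  -- angles.
  have hlaw : μ.map (fun ω i => X i ω) =
      (Measure.pi fun _ => uniformAngle).map fun (θ : Fin 3 → ℝ) i => circlePoint (θ i) := by
    rw [(ProbabilityTheory.iIndepFun_iff_map_fun_eq_pi_map fun i => (hmeas i).aemeasurable).1 hindep,
      Measure.pi_map_pi fun _ => hc.aemeasurable]
    simp only [map_eq_of_isUniform (hunif _)]
  have hT : Measurable fun x : Fin 3 → UnitCircle =>
      triangleBarLength (x 0) (x 1) (x 2) :=
    measurable_triangleBarLength (measurable_pi_apply 0).subtype_val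
      (measurable_pi_apply 1).subtype_val (measurable_pi_apply 2).subtype_val
  rw [← integral_triangleBarLength_angles,
    ← integral_map (measurable_pi_lambda _ hmeas).aemeasurable
      (f := fun x : Fin 3 → UnitCircle => triangleBarLength (x 0) (x 1) (x 2))
      hT.aestronglyMeasurable,
    hlaw, integral_map hcpi.aemeasurable hT.aestronglyMeasurable]
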